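/- Let $N\ge 2$. Consider agents $\dot x_i=A_ix_i+B_iu_i$, $y_i=C_ix_i$ ($i=1,\dots,N$) with $x_i\in\mathbb R^{n_i}$, $u_i,y_i\in\mathbb R$, each triple $(C_i,A_i,B_i)$ minimal, and costs $f_i\in C^2(\mathbb R)$. Assume: 1. $\underline h_i\le f_i''(s)\le\bar h_i$ for all $s\in\mathbb R$, with constants $\bar h_i\ge\underline h_i>0$; 2. the weighted digraph with adjacency matrix $(a_{ij})$, $a_{ij}\ge 0$ (where $a_{ij}>0$ iff there is an edge from $j$ to $i$), is strongly connected and weight-balanced; 3. no agent has a transmission zero at the origin. Let $y^*$ be the minimizer of $\sum_i f_i$, $\underline h=\min_i\underline h_i$, $\bar h=\max_i\bar h_i$, and let $0=\lambda_1<\lambda_2\le\dots\le\lambda_N$ be the eigenvalues of $(L+L^\top)/2$, where $L$ is the Laplacian of the digraph. Let $(X_i,U_i)$ solve $A_iX_i+B_iU_i=0$, $C_iX_i=1$; let $K_{i1}$ be such that $\hat A_i=A_i+B_iK_{i1}$ is Hurwitz, $K_{i2}=U_i-K_{i1}X_i$, and let $\lambda_{P_i}$ be the largest eigenvalue of the positive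 definite $P_i$ with $\hat A_i^\top P_i+P_i\hat A_i=-2I$. Consider the controller $$u_i(t)=K_{i1}x_i(t^i_k)+K_{i2}z_i(t^i_k),\quad t\in[t^i_k,t^i_{k+1}),$$ $$\dot z_i=-\alpha f_i'(z_i)-\beta\sum_j a_{ij}(\tilde z_i-\tilde z_j)-\sum_j a_{ij}(\tilde v_i-\tilde v_j),\qquad \dot v_i=\alpha\beta\sum_j a_{ij}(\tilde z_i-\tilde z_j),$$ where $\tilde z_i(t)=z_i(\tilde t^i_k)$ and $\tilde v_i(t)=v_i(\tilde t^i_k)$ for $t\in[\tilde t^i_k,\tilde t^i_{k+1})$, with $t^i_0=\tilde t^i_0=0$ and $$t^i_{k+1}=\inf\{t>t^i_k:\ |K_{i1}(x_i(t^i_k)-x_i(t))+K_{i2}(z_i(t^i_k)-z_i(t))|\ge c_0+c_1e^{-\gamma t}\},$$ $$\tilde t^i_{k+1}=\inf\{t>\tilde t^i_k:\ \|(z_i(t)-z_i(\tilde t^i_k),\,v_i(t)-v_i(\tilde t^i_k))\|\ge\tilde c_0+\tilde c_1e^{-\tilde\gamma t}\}$$ ($\inf\emptyset=\infty$: no further event).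 Let $\eta>0$, $$\alpha\ge\max\Big\{1,\frac{2\eta}{\min\{\underline h,\lambda_2\}},\frac{6\bar h^2}{\underline h\lambda_2}\Big\},\qquad \beta\ge\max\Big\{1,\frac{7\alpha^2\lambda_N^2}{\lambda_2^2}\Big\}.$$ Then there is a constant $\kappa>0$ (independent of the triggering parameters and of the initial state) such that, for all $\tilde c_0,\tilde c_1\ge0$ with $\tilde c_0+\tilde c_1>0$, all $0<\tilde\gamma<\min\{1,\eta/2\}$, all $c_0\ge\tilde c_0$, $c_1\ge0$ with $c_0+c_1>0$, and all $\gamma>0$ with $\gamma<\min\{1,\frac1{2\lambda_{P_i}},\tilde\gamma\}$ for every $i$, the following hold. (a) For every trajectory of the closed loop on an interval $[0,T)$, $0<T\le\infty$ (event times may a priori accumulate at $T$, but not earlier), there is $\tau_{\min}>0$ such that $t^i_{k+1}-t^i_k>\tau_{\min}$ and $\tilde t^i_{k+1}-\tilde t^i_k>\tau_{\min}$ for all $i$ and all $k$ (as long as $t^i_k$, respectively $\tilde t^i_k$, is finite). In particular there is no Zeno behavior. (b) Along every trajectory on $[0,\infty)$, the distance of $y_i(t)$ to the interval $[y^*-\kappa(c_0+\tilde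 c_0),\,y^*+\kappa(c_0+\tilde c_0)]$ tends to $0$ as $t\to\infty$, for every $i$. (c) If $c_0=\tilde c_0=0$, there is $\rho>0$ such that for every trajectory on $[0,\infty)$ there is $M$ with $|y_i(t)-y^*|\le Me^{-\rho t}$ for all $t\ge0$ and all $i$. -/

import Mathlib

open Matrix Set Filter Topology

/-- A single-input single-output linear agent `x' = A x + B u`, `y = C x` with state space `ℝⁿ`. -/
structure LinearAgent (n : ℕ) where
  A : Matrix (Fin n) (Fin n) ℝ
  B : Fin n → ℝ
  C : Fin n → ℝ

namespace LinearAgent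

variable {n : ℕ} (S : LinearAgent n)

/-- Kalman rank condition: the columns `B, A B, …, A ^ (n-1) B` have rank `n`. -/
def Controllable : Prop :=
  (Matrix.of fun (r : Fin n) (k : Fin n) => ((S.A ^ (k : ℕ)) *ᵥ S.B) r).rank = n

/-- Kalman rank condition: the rows `C, C A, …, C A ^ (n-1)` have rank `n`. -/
def Observable : Prop :=
  (Matrix.of fun (k : Fin n) (r : Fin n) => (S.C ᵥ* (S.A ^ (k : ℕ))) r).rank = n

/-- The triple `(C, A, B)` is minimal. -/
def IsMinimal : Prop := S.Controllable ∧ S.Observable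

/-- The system matrix `[A - s I, B; C, 0]`. -/
noncomputable def systemMatrix (s : ℂ) : Matrix (Fin n ⊕ Unit) (Fin n ⊕ Unit) ℂ :=
  Matrix.fromBlocks
    (S.A.map (fun a : ℝ => (a : ℂ)) - s • (1 : Matrix (Fin n) (Fin n) ℂ))
    (Matrix.of fun r _ => (S.B r : ℂ))
    (Matrix.of fun _ r => (S.C r : ℂ))
    0

/-- `s` is a transmission zero: the system matrix at `s` has rank less than `n + 1`. -/
def IsTransmissionZero (s : ℂ) : Prop := (S.systemMatrix s).rank < n + 1

/-- The regulator equations `0 = A X + B U`, `1 = C X`. -/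
def SolvesRegulatorEquations (X : Fin n → ℝ) (U : ℝ) : Prop :=
  S.A *ᵥ X + U • S.B = 0 ∧ S.C ⬝ᵥ X = 1

/-- The closed-loop matrix `A + B K`, for a row vector `K`. -/
def closedLoopMatrix (K : Fin n → ℝ) : Matrix (Fin n) (Fin n) ℝ :=
  S.A + Matrix.vecMulVec S.B K

end LinearAgent

/-- All complex eigenvalues have negative real part. -/
def IsHurwitz {n : ℕ} (M : Matrix (Fin n) (Fin n) ℝ) : Prop :=
  ∀ μ ∈ spectrum ℂ (M.map (fun a : ℝ => (a : ℂ))), μ.re < 0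

/-- The largest eigenvalue (used for nonempty symmetric matrices). -/
noncomputable def maxEigenvalue {n : ℕ} (M : Matrix (Fin n) (Fin n) ℝ) : ℝ :=
  sSup (spectrum ℝ M)

/-- A weighted digraph on `Fin N`, given by its adjacency matrix: `weight i j` is positive if there
is an edge from `j` to `i`, and `0` otherwise. -/
structure WeightedDigraph (N : ℕ) where
  weight : Matrix (Fin N) (Fin N) ℝ
  weight_nonneg : ∀ i j, 0 ≤ weight i j

namespace WeightedDigraph

variable {N : ℕ} (G : WeightedDigraph N)

/-- There is a directed edge from `j` to `i`. -/
def Edge (j i : Fin N) : Prop := 0 < G.weight i j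

/-- Any node can be reached from any other along directed edges. -/
def StronglyConnected : Prop := ∀ i j, Relation.ReflTransGen G.Edge i j

/-- At each node the total weight of the incoming edges is that of the outgoing ones. -/
def WeightBalanced : Prop := ∀ i, ∑ j, G.weight i j = ∑ j, G.weight j i

/-- The Laplacian `L = D - A`, with `D` the diagonal matrix of the row sums. -/
def laplacian : Matrix (Fin N) (Fin N) ℝ :=
  Matrix.diagonal (fun i => ∑ j, G.weight i j) - G.weight

/-- `Sym(L) = (L + Lᵀ) / 2`. -/
noncomputable def symLaplacian : Matrix (Fin N) (Fin N) ℝ :=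
  (1 / 2 : ℝ) • (G.laplacian + G.laplacianᵀ)

theorem symLaplacian_isHermitian : G.symLaplacian.IsHermitian := by
  unfold symLaplacian Matrix.IsHermitian
  rw [Matrix.conjTranspose_eq_transpose_of_trivial, Matrix.transpose_smul, Matrix.transpose_add,
    Matrix.transpose_transpose, add_comm]

/-- The eigenvalues of `Sym(L)` in increasing order, with multiplicity: `lam 0 ≤ lam 1 ≤ …`
(Mathlib's `eigenvalues₀` is in decreasing order). -/
noncomputable def lam (k : Fin N) : ℝ :=
  G.symLaplacian_isHermitian.eigenvalues₀ (Fin.cast (Fintype.card_fin N).symm k.rev)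

end WeightedDigraph

/-- The triggering threshold `c₀ + c₁ exp (-γ t)`. -/
noncomputable def threshold (c₀ c₁ γ t : ℝ) : ℝ := c₀ + c₁ * Real.exp (-γ * t)

/-- The parameters `c₀, c₁, γ` of the control rule and `d₀, d₁, δ` of the communication rule. -/
structure TriggerParams where
  c₀ : ℝ
  c₁ : ℝ
  γ : ℝ
  d₀ : ℝ
  d₁ : ℝ
  δ : ℝ

/-- The agents, the network, the costs and the gains of the multi-rate controller. -/
structure ControlSetup (N : ℕ) (n : Fin N → ℕ) where
  agent : ∀ i, LinearAgent (n i)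
  G : WeightedDigraph N
  f : Fin N → ℝ → ℝ
  K₁ : ∀ i, Fin (n i) → ℝ
  K₂ : Fin N → ℝ
  α : ℝ
  β : ℝ

/-- The signals and event times of a run. An event time `⊤` means that the event never happens. -/
structure Run (N : ℕ) (n : Fin N → ℕ) where
  /-- agent states -/
  x : ∀ i, ℝ → Fin (n i) → ℝ
  /-- generator states -/
  z : Fin N → ℝ → ℝ
  v : Fin N → ℝ → ℝ
  /-- inputs applied to the agents -/
  u : Fin N → ℝ → ℝ
  /-- generator states broadcast last -/
  zt : Fin N → ℝ → ℝ
  vt : Fin N → ℝ → ℝ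
  /-- control update times and communication times -/
  ctrl : Fin N → ℕ → EReal
  comm : Fin N → ℕ → EReal

namespace ControlSetup

variable {N : ℕ} {n : Fin N → ℕ} (P : ControlSetup N n)

/-- The non-sampled feedback `K₁ x + K₂ z` of agent `i` at time `t`. -/
def feedback (w : Run N n) (i : Fin N) (t : ℝ) : ℝ :=
  P.K₁ i ⬝ᵥ w.x i t + P.K₂ i * w.z i t

/-- The output of agent `i` at time `t`. -/
def output (w : Run N n) (i : Fin N) (t : ℝ) : ℝ := (P.agent i).C ⬝ᵥ w.x i t

/-- `w` is a trajectory on `[0, T)`, `0 < T ≤ ∞`, of the closed loop of the agents with the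
multi-rate event-triggered controller. Event times may accumulate at `T` (so that Zeno behavior is
not excluded), but not earlier. A differential equation with a right-continuous, piecewise
continuous right-hand side is written with continuity and right derivatives. In a triggering rule
the error is that between the current value and the value sampled at the last event, before any
reset. -/
structure IsTrajectory (q : TriggerParams) (T : EReal) (w : Run N n) : Prop where
  pos : 0 < T
  ctrl_zero : ∀ i, w.ctrl i 0 = 0
  ctrl_succ : ∀ i k, w.ctrl i (k + 1) =
    sInf (Real.toEReal '' {t : ℝ | w.ctrl i k < (t : EReal) ∧ (t : EReal) < T ∧
      threshold q.c₀ q.c₁ q.γ t ≤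
        |P.feedback w i (w.ctrl i k).toReal - P.feedback w i t|})
  ctrl_cover : ∀ i (t : ℝ), 0 ≤ t → (t : EReal) < T →
    ∃ k, w.ctrl i k ≤ (t : EReal) ∧ (t : EReal) < w.ctrl i (k + 1)
  comm_zero : ∀ i, w.comm i 0 = 0
  comm_succ : ∀ i k, w.comm i (k + 1) =
    sInf (Real.toEReal '' {t : ℝ | w.comm i k < (t : EReal) ∧ (t : EReal) < T ∧
      threshold q.d₀ q.d₁ q.δ t ≤
        √((w.z i t - w.z i (w.comm i k).toReal) ^ 2 + (w.v i t - w.v i (w.comm i k).toReal) ^ 2)})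
  comm_cover : ∀ i (t : ℝ), 0 ≤ t → (t : EReal) < T →
    ∃ k, w.comm i k ≤ (t : EReal) ∧ (t : EReal) < w.comm i (k + 1)
  input_hold : ∀ i k (t : ℝ), (t : EReal) < T → w.ctrl i k ≤ (t : EReal) →
    (t : EReal) < w.ctrl i (k + 1) → w.u i t = P.feedback w i (w.ctrl i k).toReal
  z_hold : ∀ i k (t : ℝ), (t : EReal) < T → w.comm i k ≤ (t : EReal) →
    (t : EReal) < w.comm i (k + 1) → w.zt i t = w.z i (w.comm i k).toReal
  v_hold : ∀ i k (t : ℝ), (t : EReal) < T → w.comm i k ≤ (t : EReal) →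
    (t : EReal) < w.comm i (k + 1) → w.vt i t = w.v i (w.comm i k).toReal
  x_cont : ∀ i, ContinuousOn (w.x i) {t : ℝ | 0 ≤ t ∧ (t : EReal) < T}
  z_cont : ∀ i, ContinuousOn (w.z i) {t : ℝ | 0 ≤ t ∧ (t : EReal) < T}
  v_cont : ∀ i, ContinuousOn (w.v i) {t : ℝ | 0 ≤ t ∧ (t : EReal) < T}
  x_deriv : ∀ i (t : ℝ), 0 ≤ t → (t : EReal) < T →
    HasDerivWithinAt (w.x i) ((P.agent i).A *ᵥ w.x i t + w.u i t • (P.agent i).B) (Ici t) t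
  z_deriv : ∀ i (t : ℝ), 0 ≤ t → (t : EReal) < T →
    HasDerivWithinAt (w.z i)
      (-P.α * deriv (P.f i) (w.z i t)
        - P.β * ∑ j, P.G.weight i j * (w.zt i t - w.zt j t)
        - ∑ j, P.G.weight i j * (w.vt i t - w.vt j t)) (Ici t) t
  v_deriv : ∀ i (t : ℝ), 0 ≤ t → (t : EReal) < T →
    HasDerivWithinAt (w.v i)
      (P.α * P.β * ∑ j, P.G.weight i j * (w.zt i t - w.zt j t)) (Ici t) t

end ControlSetup

/-! The triggering rules matter only through the fact that each sampling error stays below its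
threshold. So the closed loop is a generator with small perturbations that drives stable linear
systems, and every estimate can be made a priori on `[0, T)`, before Zeno behavior is excluded.

Generator. Let `e` be the deviation of `z` from the minimizer `y`. Let `v₀` satisfy `L v₀ = -α
f'(y)`, which is solvable because the entries `f_i'(y)` sum to zero. Let `p` be `v - v₀ + α e` with
its mean removed. In these variables the terms with `β` cancel from `p'`, and `V = α³ |e|² + |p|²`
decays: strong convexity damps `e`, the spectral gap `λ₂` damps the mean-zero `p`, and the large
term `-β L e` absorbs the cross terms between `e` and `p` (`generator_decay`). With sampling errors,
`V' ≤ -η V + C |errors|²`, so a comparison argument bounds `V` by a multiple of `d₀²` plus a term of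
order `exp (-2δt)` (`generator_bound`).

Agents. The regulator equations turn `x - y X` into the state of the Hurwitz system `F = A + B K₁`,
whose scalar input consists of `K₂ (z - y)` and the sampling error of the feedback. The Lyapunov
function given by `Q` yields the same kind of bound with `c₀` and `γ` (`agent_bound`). Claims (b)
and (c) are read off from it.

Inter-event times. The derivatives of the sampled signals obey the same bounds, hence are at most a
constant times the current threshold, even if the threshold tends to zero. Since the rates are at
most `1`, a threshold loses at most the fraction `h` of its value in a time `h`. So the error needs
a uniform time to reach it, which is (a). -/

/-! ### Quadratic forms of symmetric matrices in an eigenbasis -/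

section Spectral

variable {ι : Type*} [Fintype ι] [DecidableEq ι] {M : Matrix ι ι ℝ}

theorem Matrix.IsHermitian.dotProduct_self_eq_sum (hM : M.IsHermitian) (x : ι → ℝ) :
    x ⬝ᵥ x = ∑ i, (⇑(hM.eigenvectorBasis i) ⬝ᵥ x) ^ 2 := by
  have h := hM.eigenvectorBasis.sum_inner_mul_inner (WithLp.toLp 2 x) (WithLp.toLp 2 x)
  simp only [EuclideanSpace.inner_eq_star_dotProduct, star_trivial] at h
  rw [← h]
  refine Finset.sum_congr rfl fun i _ => ?_
  rw [dotProduct_comm x, sq]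

theorem Matrix.IsHermitian.dotProduct_mulVec_eq_sum (hM : M.IsHermitian) (x : ι → ℝ) :
    x ⬝ᵥ M *ᵥ x = ∑ i, hM.eigenvalues i * (⇑(hM.eigenvectorBasis i) ⬝ᵥ x) ^ 2 := by
  have h := hM.eigenvectorBasis.sum_inner_mul_inner (WithLp.toLp 2 x) (WithLp.toLp 2 (M *ᵥ x))
  simp only [EuclideanSpace.inner_eq_star_dotProduct, star_trivial] at h
  rw [dotProduct_comm x, ← h]
  refine Finset.sum_congr rfl fun i _ => ?_
  have hsymm : Mᵀ = M := by simpa [IsHermitian, conjTranspose_eq_transpose_of_trivial] using hM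
  have h1 : (M *ᵥ x) ⬝ᵥ ⇑(hM.eigenvectorBasis i)
      = hM.eigenvalues i * (⇑(hM.eigenvectorBasis i) ⬝ᵥ x) := by
    rw [dotProduct_comm, dotProduct_mulVec, ← mulVec_transpose, hsymm, hM.mulVec_eigenvectorBasis,
      smul_dotProduct, smul_eq_mul]
  rw [h1]; ring

theorem Matrix.IsHermitian.eigenvectorBasis_dotProduct_self (hM : M.IsHermitian) (i : ι) :
    (hM.eigenvectorBasis i : ι → ℝ) ⬝ᵥ (hM.eigenvectorBasis i : ι → ℝ) = 1 := by
  have h := (orthonormal_iff_ite.mp hM.eigenvectorBasis.orthonormal) i i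
  rwa [if_pos rfl, EuclideanSpace.inner_eq_star_dotProduct, star_trivial] at h

theorem Matrix.IsHermitian.eigenvectorBasis_dotProduct_of_ne (hM : M.IsHermitian) {i j : ι}
    (hij : i ≠ j) :
    (hM.eigenvectorBasis i : ι → ℝ) ⬝ᵥ (hM.eigenvectorBasis j : ι → ℝ) = 0 := by
  have h := (orthonormal_iff_ite.mp hM.eigenvectorBasis.orthonormal) j i
  rwa [if_neg hij.symm, EuclideanSpace.inner_eq_star_dotProduct, star_trivial] at h

theorem Matrix.IsHermitian.dotProduct_mulVec_le (hM : M.IsHermitian) {c : ℝ}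
    (hc : ∀ i, hM.eigenvalues i ≤ c) (x : ι → ℝ) : x ⬝ᵥ M *ᵥ x ≤ c * (x ⬝ᵥ x) := by
  rw [hM.dotProduct_mulVec_eq_sum, hM.dotProduct_self_eq_sum x, Finset.mul_sum]
  exact Finset.sum_le_sum fun i _ => mul_le_mul_of_nonneg_right (hc i) (sq_nonneg _)

theorem Matrix.PosDef.exists_mul_dotProduct_le [Nonempty ι] (hM : M.PosDef) :
    ∃ m : ℝ, 0 < m ∧ ∀ x : ι → ℝ, m * (x ⬝ᵥ x) ≤ x ⬝ᵥ M *ᵥ x := by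
  obtain ⟨i₀, hi₀⟩ := Finite.exists_min hM.isHermitian.eigenvalues
  refine ⟨_, hM.eigenvalues_pos i₀, fun x => ?_⟩
  rw [hM.isHermitian.dotProduct_mulVec_eq_sum, hM.isHermitian.dotProduct_self_eq_sum x,
    Finset.mul_sum]
  exact Finset.sum_le_sum fun i _ => mul_le_mul_of_nonneg_right (hi₀ i) (sq_nonneg _)

end Spectral

theorem dotProduct_mulVec_le_maxEigenvalue {n : ℕ} {M : Matrix (Fin n) (Fin n) ℝ}
    (hM : M.IsHermitian) (x : Fin n → ℝ) : x ⬝ᵥ M *ᵥ x ≤ maxEigenvalue M * (x ⬝ᵥ x) :=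
  hM.dotProduct_mulVec_le (fun i => le_csSup M.finite_real_spectrum.bddAbove
    (hM.eigenvalues_mem_spectrum_real i)) x

/-! ### Laplacian and disagreement of a weight-balanced digraph -/

section GraphSums

variable {ι : Type*} [Fintype ι] {a : ι → ι → ℝ}

/-- The action of the Laplacian of the weights `a` on `x`. -/
def lap (a : ι → ι → ℝ) (x : ι → ℝ) (i : ι) : ℝ := ∑ j, a i j * (x i - x j)

/-- The disagreement `½ ∑ aᵢⱼ (xᵢ - xⱼ)²`. -/
noncomputable def disagreement (a : ι → ι → ℝ) (x : ι → ℝ) : ℝ :=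
  (1 / 2) * ∑ i, ∑ j, a i j * (x i - x j) ^ 2

theorem lap_add (x y : ι → ℝ) : lap a (x + y) = lap a x + lap a y := by
  funext i
  simp only [lap, Pi.add_apply, ← Finset.sum_add_distrib]
  exact Finset.sum_congr rfl fun j _ => by ring

theorem lap_smul (c : ℝ) (x : ι → ℝ) : lap a (c • x) = c • lap a x := by
  funext i
  simp only [lap, Pi.smul_apply, smul_eq_mul, Finset.mul_sum]
  exact Finset.sum_congr rfl fun j _ => by ring

theorem lap_sub (x y : ι → ℝ) : lap a (x - y) = lap a x - lap a y := by
  funext i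
  simp only [lap, Pi.sub_apply, ← Finset.sum_sub_distrib]
  exact Finset.sum_congr rfl fun j _ => by ring

theorem lap_const (c : ℝ) : lap a (fun _ => c) = 0 := by
  funext i; simp [lap]

theorem disagreement_nonneg (ha : ∀ i j, 0 ≤ a i j) (x : ι → ℝ) : 0 ≤ disagreement a x :=
  mul_nonneg (by norm_num) (Finset.sum_nonneg fun i _ => Finset.sum_nonneg fun j _ =>
    mul_nonneg (ha i j) (sq_nonneg _))

/-- The only way in which weight balance enters the sums: in-degrees may be replaced by out-degrees.
-/
theorem sum_sum_mul_left_eq_right (hbal : ∀ i, ∑ j, a i j = ∑ j, a j i) (g : ι → ℝ) :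
    ∑ i, ∑ j, a i j * g i = ∑ i, ∑ j, a i j * g j := by
  rw [Finset.sum_comm (f := fun i j => a i j * g j)]
  refine Finset.sum_congr rfl fun i _ => ?_
  rw [← Finset.sum_mul, ← Finset.sum_mul, hbal]

theorem sum_lap (hbal : ∀ i, ∑ j, a i j = ∑ j, a j i) (x : ι → ℝ) : ∑ i, lap a x i = 0 := by
  simp only [lap, mul_sub, Finset.sum_sub_distrib]
  rw [sum_sum_mul_left_eq_right hbal, sub_self]

theorem dotProduct_lap_self (hbal : ∀ i, ∑ j, a i j = ∑ j, a j i) (x : ι → ℝ) :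
    x ⬝ᵥ lap a x = disagreement a x := by
  have h := sum_sum_mul_left_eq_right hbal (fun i => x i ^ 2)
  have h1 : x ⬝ᵥ lap a x = ∑ i, ∑ j, a i j * x i ^ 2 - ∑ i, ∑ j, a i j * (x i * x j) := by
    simp only [dotProduct, lap, Finset.mul_sum, ← Finset.sum_sub_distrib]
    exact Finset.sum_congr rfl fun i _ => Finset.sum_congr rfl fun j _ => by ring
  have h2 : disagreement a x = (1 / 2) * (∑ i, ∑ j, a i j * x i ^ 2 + ∑ i, ∑ j, a i j * x j ^ 2
      - 2 * ∑ i, ∑ j, a i j * (x i * x j)) := by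
    simp only [disagreement, Finset.mul_sum, ← Finset.sum_sub_distrib, ← Finset.sum_add_distrib]
    exact Finset.sum_congr rfl fun i _ => Finset.sum_congr rfl fun j _ => by ring
  rw [h1, h2, ← h]; ring

/-- By weight balance the adjoint of the Laplacian is the Laplacian of the reversed graph, so bounds
on `lap` also control the transposed cross term. -/
theorem dotProduct_lap (hbal : ∀ i, ∑ j, a i j = ∑ j, a j i) (x y : ι → ℝ) :
    x ⬝ᵥ lap a y = y ⬝ᵥ lap (fun i j => a j i) x := by
  have h1 : x ⬝ᵥ lap a y = ∑ i, ∑ j, a i j * (x i * y i) - ∑ i, ∑ j, a i j * (x i * y j) := by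
    simp only [dotProduct, lap, Finset.mul_sum, ← Finset.sum_sub_distrib]
    exact Finset.sum_congr rfl fun i _ => Finset.sum_congr rfl fun j _ => by ring
  have h2 : y ⬝ᵥ lap (fun i j => a j i) x
      = ∑ i, ∑ j, a j i * (x i * y i) - ∑ i, ∑ j, a j i * (x j * y i) := by
    simp only [dotProduct, lap, Finset.mul_sum, ← Finset.sum_sub_distrib]
    exact Finset.sum_congr rfl fun i _ => Finset.sum_congr rfl fun j _ => by ring
  rw [h1, h2, sum_sum_mul_left_eq_right hbal (fun i => x i * y i),
    Finset.sum_comm (f := fun i j => a j i * (x i * y i)),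
    Finset.sum_comm (f := fun i j => a j i * (x j * y i))]

theorem disagreement_transpose (x : ι → ℝ) :
    disagreement (fun i j => a j i) x = disagreement a x := by
  unfold disagreement
  rw [Finset.sum_comm]
  congr 1
  exact Finset.sum_congr rfl fun i _ => Finset.sum_congr rfl fun j _ => by ring

/-- Weighted Cauchy–Schwarz at each node. Bounding `|L x|²` by the disagreement instead of `|x|²` is
what later lets the term `-β L e` absorb the cross terms. -/
theorem lap_dotProduct_lap_le (ha : ∀ i j, 0 ≤ a i j) {D : ℝ}
    (hD : ∀ i, ∑ j, a i j - a i i ≤ D) (x : ι → ℝ) :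
    lap a x ⬝ᵥ lap a x ≤ 2 * D * disagreement a x := by
  classical
  have key : ∀ i, lap a x i * lap a x i ≤ D * ∑ j, a i j * (x i - x j) ^ 2 := by
    intro i
    -- A self-loop contributes nothing to `lap`, so its weight is left out of the degree.
    have h := Finset.sum_sq_le_sum_mul_sum_of_sq_le_mul Finset.univ
      (r := fun j => a i j * (x i - x j)) (f := fun j => if j = i then 0 else a i j)
      (g := fun j => a i j * (x i - x j) ^ 2)
      (fun j _ => by split_ifs; exacts [le_rfl, ha i j])
      (fun j _ => mul_nonneg (ha i j) (sq_nonneg _))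
      (fun j _ => by
        split_ifs with h
        · simp [h]
        · exact le_of_eq (by ring))
    have h3 : ∑ j, (if j = i then 0 else a i j) = ∑ j, a i j - a i i := by
      rw [← Finset.add_sum_erase _ (fun j => a i j) (Finset.mem_univ i), add_sub_cancel_left,
        ← Finset.sum_erase (a := i) _ (by simp)]
      exact Finset.sum_congr rfl fun j hj => by simp [Finset.ne_of_mem_erase hj]
    rw [h3] at h
    rw [← sq]
    exact h.trans (mul_le_mul_of_nonneg_right (hD i)
      (Finset.sum_nonneg fun j _ => mul_nonneg (ha i j) (sq_nonneg _)))
  calc lap a x ⬝ᵥ lap a x ≤ ∑ i, D * ∑ j, a i j * (x i - x j) ^ 2 :=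
        Finset.sum_le_sum fun i _ => key i
    _ = 2 * D * disagreement a x := by rw [disagreement, ← Finset.mul_sum]; ring

theorem dotProduct_sq_le (x y : ι → ℝ) : (x ⬝ᵥ y) ^ 2 ≤ (x ⬝ᵥ x) * (y ⬝ᵥ y) := by
  simpa [dotProduct, sq] using Finset.sum_mul_sq_le_sq_mul_sq Finset.univ x y

end GraphSums

/-! ### Spectrum of the symmetrized Laplacian -/

namespace WeightedDigraph

variable {N : ℕ} (G : WeightedDigraph N)

theorem laplacian_mulVec (x : Fin N → ℝ) : G.laplacian *ᵥ x = lap G.weight x := by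
  funext i
  simp only [laplacian, sub_mulVec, Pi.sub_apply, mulVec_diagonal, lap, mul_sub,
    Finset.sum_sub_distrib, Finset.sum_mul]
  rfl

theorem dotProduct_symLaplacian (hbal : G.WeightBalanced) (x : Fin N → ℝ) :
    x ⬝ᵥ G.symLaplacian *ᵥ x = disagreement G.weight x := by
  have h : x ⬝ᵥ G.laplacianᵀ *ᵥ x = x ⬝ᵥ G.laplacian *ᵥ x := by
    rw [mulVec_transpose, dotProduct_comm, ← dotProduct_mulVec]
  rw [symLaplacian, smul_mulVec, add_mulVec, dotProduct_smul, dotProduct_add, h,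
    laplacian_mulVec, dotProduct_lap_self hbal, smul_eq_mul]
  ring

variable {G}

/-- All terms are nonnegative, so each vanishes; `x` is then equal across every edge, hence along
every path. -/
theorem eq_of_disagreement_eq_zero (hconn : G.StronglyConnected) {x : Fin N → ℝ}
    (hx : disagreement G.weight x = 0) (i j : Fin N) : x i = x j := by
  have hterm : ∀ i j, G.weight i j * (x i - x j) ^ 2 = 0 := by
    have hnn : ∀ i j, 0 ≤ G.weight i j * (x i - x j) ^ 2 :=
      fun i j => mul_nonneg (G.weight_nonneg i j) (sq_nonneg _)
    have h0 : ∑ i, ∑ j, G.weight i j * (x i - x j) ^ 2 = 0 := by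
      unfold disagreement at hx; linarith
    intro i j
    have h1 := (Finset.sum_eq_zero_iff_of_nonneg
      (fun i _ => Finset.sum_nonneg fun j _ => hnn i j)).mp h0 i (Finset.mem_univ i)
    exact (Finset.sum_eq_zero_iff_of_nonneg (fun j _ => hnn i j)).mp h1 j (Finset.mem_univ j)
  induction hconn i j with
  | refl => rfl
  | tail _ hbc ih =>
    rw [ih]
    rename_i b c _
    have hpos : 0 < G.weight c b := hbc
    have h1 := hterm c b
    rcases mul_eq_zero.mp h1 with h | h
    · exact absurd h hpos.ne'
    · have := pow_eq_zero_iff (two_ne_zero) |>.mp h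
      linarith

end WeightedDigraph

namespace WeightedDigraph

variable {N : ℕ} {G : WeightedDigraph N}

theorem lam_mono : Monotone G.lam := fun _ _ hkl =>
  G.symLaplacian_isHermitian.eigenvalues₀_antitone
    (Fin.cast_le_cast _ |>.mpr (Fin.rev_le_rev.mpr hkl))

theorem exists_perm_lam_eq_eigenvalues :
    ∃ σ : Fin N ≃ Fin N, ∀ k, G.lam k = G.symLaplacian_isHermitian.eigenvalues (σ k) :=
  ⟨Fin.revPerm.trans ((finCongr (Fintype.card_fin N).symm).trans
    (Fintype.equivOfCardEq (Fintype.card_fin _))), fun k => by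
      simp [lam, IsHermitian.eigenvalues]⟩

theorem eigenvalue_eq_disagreement (hbal : G.WeightBalanced) (i : Fin N) :
    G.symLaplacian_isHermitian.eigenvalues i
      = disagreement G.weight (G.symLaplacian_isHermitian.eigenvectorBasis i) := by
  rw [← dotProduct_symLaplacian G hbal, G.symLaplacian_isHermitian.mulVec_eigenvectorBasis,
    dotProduct_smul, G.symLaplacian_isHermitian.eigenvectorBasis_dotProduct_self, smul_eq_mul,
    mul_one]

theorem lam_nonneg (hbal : G.WeightBalanced) (k : Fin N) : 0 ≤ G.lam k := by
  obtain ⟨σ, hσ⟩ := exists_perm_lam_eq_eigenvalues (G := G)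
  rw [hσ, eigenvalue_eq_disagreement hbal]
  exact disagreement_nonneg G.weight_nonneg _

/-- Otherwise the two lowest eigenvalues vanish, and both eigenvectors have zero disagreement. They
are then constant, and two constant unit vectors cannot be orthogonal. -/
theorem lam_one_pos (hN : 2 ≤ N) (hconn : G.StronglyConnected) (hbal : G.WeightBalanced) :
    0 < G.lam ⟨1, hN⟩ := by
  obtain ⟨σ, hσ⟩ := exists_perm_lam_eq_eigenvalues (G := G)
  refine (lam_nonneg hbal _).lt_of_ne fun h1 => ?_
  have h0 : G.lam ⟨0, by omega⟩ = 0 :=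
    le_antisymm (h1 ▸ lam_mono (Fin.mk_le_mk.mpr zero_le_one)) (lam_nonneg hbal _)
  have hM := G.symLaplacian_isHermitian
  have hconst : ∀ k, G.lam k = 0 → ∃ c, (hM.eigenvectorBasis (σ k) : Fin N → ℝ) = fun _ => c := by
    intro k hk
    rw [hσ, eigenvalue_eq_disagreement hbal] at hk
    exact ⟨_, funext fun i => eq_of_disagreement_eq_zero hconn hk i ⟨0, by omega⟩⟩
  obtain ⟨c, hc⟩ := hconst _ h0
  obtain ⟨d, hd⟩ := hconst _ h1.symm
  have hcc := hM.eigenvectorBasis_dotProduct_self (σ ⟨0, by omega⟩)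
  have hdd := hM.eigenvectorBasis_dotProduct_self (σ ⟨1, hN⟩)
  have hcd := hM.eigenvectorBasis_dotProduct_of_ne (i := σ ⟨0, by omega⟩) (j := σ ⟨1, hN⟩)
    (fun h => by simpa using σ.injective h)
  rw [hc] at hcc hcd
  rw [hd] at hdd hcd
  simp only [dotProduct, Finset.sum_const, Finset.card_univ, Fintype.card_fin, nsmul_eq_mul]
    at hcc hdd hcd
  have : (N * (c * d)) ^ 2 = (N * (c * c)) * (N * (d * d)) := by ring
  rw [hcc, hdd, hcd] at this
  norm_num at this

theorem eigenvalues_le_lam_last (hN : 2 ≤ N) (i : Fin N) :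
    G.symLaplacian_isHermitian.eigenvalues i ≤ G.lam ⟨N - 1, Nat.sub_one_lt_of_lt hN⟩ := by
  obtain ⟨σ, hσ⟩ := exists_perm_lam_eq_eigenvalues (G := G)
  rw [← σ.apply_symm_apply i, ← hσ]
  exact lam_mono (Fin.mk_le_mk.mpr (by omega))

theorem disagreement_le (hN : 2 ≤ N) (hbal : G.WeightBalanced) (x : Fin N → ℝ) :
    disagreement G.weight x ≤ G.lam ⟨N - 1, Nat.sub_one_lt_of_lt hN⟩ * (x ⬝ᵥ x) := by
  rw [← dotProduct_symLaplacian G hbal]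
  exact G.symLaplacian_isHermitian.dotProduct_mulVec_le (eigenvalues_le_lam_last hN) x

/-- Test the quadratic form on a standard basis vector: its disagreement is the degree without the
self-loop. -/
theorem degree_le_lam_last (hN : 2 ≤ N) (hbal : G.WeightBalanced) (i : Fin N) :
    ∑ j, G.weight i j - G.weight i i ≤ G.lam ⟨N - 1, Nat.sub_one_lt_of_lt hN⟩ := by
  have h := disagreement_le hN hbal (Pi.single i 1)
  rw [← dotProduct_lap_self hbal] at h
  simpa [lap, mul_sub, Finset.sum_sub_distrib, Pi.single_apply] using h

/-- The constant vector has zero disagreement, so it is orthogonal to every eigenvector with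
positive eigenvalue and spans the lowest eigenline. A mean-zero `x` therefore has no component
there, and all other eigenvalues are at least `lam 1`. -/
theorem lam_one_mul_le_disagreement (hN : 2 ≤ N) (hconn : G.StronglyConnected)
    (hbal : G.WeightBalanced) (x : Fin N → ℝ) (hx : ∑ i, x i = 0) :
    G.lam ⟨1, hN⟩ * (x ⬝ᵥ x) ≤ disagreement G.weight x := by
  obtain ⟨σ, hσ⟩ := exists_perm_lam_eq_eigenvalues (G := G)
  have hM := G.symLaplacian_isHermitian
  have hpos := lam_one_pos hN hconn hbal
  have hle : ∀ i, i ≠ σ ⟨0, by omega⟩ → G.lam ⟨1, hN⟩ ≤ hM.eigenvalues i := by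
    intro i hi
    rw [← σ.apply_symm_apply i, ← hσ]
    refine lam_mono (Fin.mk_le_mk.mpr (Nat.one_le_iff_ne_zero.mpr fun h => hi ?_))
    rw [← σ.apply_symm_apply i]
    congr 1
    exact Fin.ext h
  -- the other eigenvectors are orthogonal to the constant vector
  have hone : ∀ i, i ≠ σ ⟨0, by omega⟩ →
      (hM.eigenvectorBasis i : Fin N → ℝ) ⬝ᵥ (fun _ => 1) = 0 := by
    have h0 : disagreement G.weight (fun _ : Fin N => (1 : ℝ)) = 0 := by simp [disagreement]
    rw [← dotProduct_symLaplacian G hbal, hM.dotProduct_mulVec_eq_sum,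
      Finset.sum_eq_zero_iff_of_nonneg (fun i _ => mul_nonneg (by
        rw [eigenvalue_eq_disagreement hbal]
        exact disagreement_nonneg G.weight_nonneg _) (sq_nonneg _))] at h0
    intro i hi
    rcases mul_eq_zero.mp (h0 i (Finset.mem_univ i)) with h | h
    · exact absurd h (hpos.trans_le (hle i hi)).ne'
    · exact pow_eq_zero_iff two_ne_zero |>.mp h
  have hsum := hM.eigenvectorBasis.sum_inner_mul_inner (WithLp.toLp 2 x)
    (WithLp.toLp 2 (fun _ => 1))
  have hones := hM.dotProduct_self_eq_sum (fun _ => 1)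
  simp only [EuclideanSpace.inner_eq_star_dotProduct, star_trivial] at hsum
  rw [Finset.sum_eq_single (σ ⟨0, by omega⟩)
    (fun i _ hi => by rw [dotProduct_comm (fun _ => (1 : ℝ)), hone i hi, mul_zero])
    (by simp)] at hsum
  rw [Finset.sum_eq_single (σ ⟨0, by omega⟩) (fun i _ hi => by rw [hone i hi]; norm_num)
    (by simp)] at hones
  have hne : (hM.eigenvectorBasis (σ ⟨0, by omega⟩) : Fin N → ℝ) ⬝ᵥ (fun _ => 1) ≠ 0 := by
    intro h
    rw [h] at hones
    simp [dotProduct] at hones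
    omega
  have hx0 : (hM.eigenvectorBasis (σ ⟨0, by omega⟩) : Fin N → ℝ) ⬝ᵥ x = 0 := by
    rw [dotProduct_comm (fun _ => (1 : ℝ)), dotProduct_comm (fun _ => (1 : ℝ)) x,
      show x ⬝ᵥ (fun _ => (1 : ℝ)) = 0 by simpa [dotProduct] using hx] at hsum
    exact (mul_eq_zero.mp hsum).resolve_right hne
  rw [← dotProduct_symLaplacian G hbal, hM.dotProduct_mulVec_eq_sum, hM.dotProduct_self_eq_sum x,
    Finset.mul_sum]
  refine Finset.sum_le_sum fun i _ => ?_
  by_cases hi : i = σ ⟨0, by omega⟩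
  · rw [hi, hx0]; simp
  · exact mul_le_mul_of_nonneg_right (hle i hi) (sq_nonneg _)

end WeightedDigraph

/-! ### Equilibrium of the generator and decay of its Lyapunov function -/

section StaticEstimates

variable {ι : Type*} [Fintype ι] {a : ι → ι → ℝ}

theorem lap_dotProduct_lap_le_sq (ha : ∀ i j, 0 ≤ a i j) {m : ℝ} (hm : 0 ≤ m)
    (hD : ∀ i, ∑ j, a i j - a i i ≤ m) (hmax : ∀ x, disagreement a x ≤ m * (x ⬝ᵥ x)) (x : ι → ℝ) :
    lap a x ⬝ᵥ lap a x ≤ 2 * m ^ 2 * (x ⬝ᵥ x) :=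
  (lap_dotProduct_lap_le ha hD x).trans (by nlinarith [hmax x])

/-- Adding the all-ones matrix to the Laplacian makes the quadratic form definite, hence the map
onto. If `g` has mean zero then so has the preimage, and the added term vanishes on it. -/
theorem exists_lap_eq (hbal : ∀ i, ∑ j, a i j = ∑ j, a j i) {l : ℝ} (hl : 0 < l)
    (ha : ∀ i j, 0 ≤ a i j)
    (hmin : ∀ x : ι → ℝ, ∑ i, x i = 0 → l * (x ⬝ᵥ x) ≤ disagreement a x)
    {g : ι → ℝ} (hg : ∑ i, g i = 0) : ∃ v, lap a v = g := by
  let F : (ι → ℝ) →ₗ[ℝ] (ι → ℝ) :=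
    { toFun := fun x => lap a x + fun _ => ∑ i, x i
      map_add' := fun x y => by
        funext i
        simp only [lap_add, Pi.add_apply, Finset.sum_add_distrib]; ring
      map_smul' := fun c x => by
        funext i
        simp only [lap_smul, Pi.add_apply, Pi.smul_apply, smul_eq_mul, ← Finset.mul_sum,
          RingHom.id_apply]
        ring }
  have hF : ∀ x, F x = lap a x + fun _ => ∑ i, x i := fun _ => rfl
  have hinj : Function.Injective F := by
    rw [injective_iff_map_eq_zero]
    intro x hx
    have h1 : x ⬝ᵥ F x = disagreement a x + (∑ i, x i) ^ 2 := by
      rw [hF, dotProduct_add, dotProduct_lap_self hbal]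
      simp only [dotProduct, ← Finset.sum_mul, sq]
    rw [hx, dotProduct_zero] at h1
    have h2 := disagreement_nonneg ha x
    have h3 : ∑ i, x i = 0 := pow_eq_zero_iff two_ne_zero |>.mp (by nlinarith [sq_nonneg (∑ i, x i)])
    have h4 := hmin x h3
    have h5 : 0 ≤ x ⬝ᵥ x := Finset.sum_nonneg fun i _ => mul_self_nonneg _
    have h6 : disagreement a x = 0 := by nlinarith
    exact dotProduct_self_eq_zero.mp (le_antisymm (by nlinarith) h5)
  obtain ⟨v, hv⟩ := LinearMap.injective_iff_surjective.mp hinj g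
  rw [hF] at hv
  have hsum : ∑ i, v i = 0 := by
    have h := hg
    simp only [← hv, Pi.add_apply, Finset.sum_add_distrib, sum_lap hbal, Finset.sum_const,
      Finset.card_univ, nsmul_eq_mul, zero_add] at h
    rcases mul_eq_zero.mp h with h | h
    · have : IsEmpty ι := Fintype.card_eq_zero_iff.mp (by exact_mod_cast h)
      simp
    · exact h
  refine ⟨v, ?_⟩
  rw [← hv, hsum]
  funext i; simp

theorem two_mul_abs_le_of_sq_le {x A B c : ℝ} (hc : 0 < c) (hA : 0 ≤ A) (hB : 0 ≤ B)
    (h : x ^ 2 ≤ A * B) : 2 * |x| ≤ c * A + B / c := by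
  have h1 : (2 * |x|) ^ 2 ≤ (c * A + B / c) ^ 2 := by
    have : (c * A + B / c) ^ 2 = (c * A - B / c) ^ 2 + 4 * (A * B) := by field_simp; ring
    rw [this, mul_pow, sq_abs]
    nlinarith [sq_nonneg (c * A - B / c)]
  exact abs_le_of_sq_le_sq' h1 (by positivity) |>.2

/-- The decay of `α³ |e|² + |p|²` along the generator dynamics without sampling errors. -/
theorem generator_decay (ha : ∀ i j, 0 ≤ a i j) (hbal : ∀ i, ∑ j, a i j = ∑ j, a j i)
    {l m : ℝ} (hl : 0 < l) (hlm : l ≤ m) (hD : ∀ i, ∑ j, a i j - a i i ≤ m)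
    (hmin : ∀ x : ι → ℝ, ∑ i, x i = 0 → l * (x ⬝ᵥ x) ≤ disagreement a x)
    {e p h : ι → ℝ} (hp : ∑ i, p i = 0) {c₁ c₂ α β η : ℝ}
    (heh : c₁ * (e ⬝ᵥ e) ≤ e ⬝ᵥ h) (hh : h ⬝ᵥ h ≤ c₂ ^ 2 * (e ⬝ᵥ e))
    (hα : 1 ≤ α) (hη₁ : 2 * η ≤ α * c₁) (hη₂ : 2 * η ≤ α * l)
    (hα' : 6 * c₂ ^ 2 ≤ α * (c₁ * l)) (hβ : 7 * α ^ 2 * m ^ 2 ≤ β * l ^ 2) :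
    α ^ 3 * (e ⬝ᵥ (-α • h - β • lap a e - lap a (p - α • e)))
      + p ⬝ᵥ (-α ^ 2 • h - α • lap a p + α ^ 2 • lap a e)
      ≤ -η * (α ^ 3 * (e ⬝ᵥ e) + p ⬝ᵥ p) := by
  have hα0 : 0 < α := by linarith
  have hm : 0 < m := by linarith
  have hE : 0 ≤ e ⬝ᵥ e := Finset.sum_nonneg fun i _ => mul_self_nonneg _
  have hP : 0 ≤ p ⬝ᵥ p := Finset.sum_nonneg fun i _ => mul_self_nonneg _
  have hH : 0 ≤ h ⬝ᵥ h := Finset.sum_nonneg fun i _ => mul_self_nonneg _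
  have hs := disagreement_nonneg ha e
  have hsp := hmin p hp
  have hDt : ∀ i, ∑ j, a j i - a i i ≤ m := fun i => hbal i ▸ hD i
  have hx1 : (e ⬝ᵥ lap a p) ^ 2 ≤ (p ⬝ᵥ p) * (2 * m * disagreement a e) := by
    rw [dotProduct_lap hbal]
    refine (dotProduct_sq_le _ _).trans (mul_le_mul_of_nonneg_left ?_ hP)
    simpa [disagreement_transpose] using
      lap_dotProduct_lap_le (a := fun i j => a j i) (fun i j => ha j i) hDt e
  have hx2 : (p ⬝ᵥ lap a e) ^ 2 ≤ (p ⬝ᵥ p) * (2 * m * disagreement a e) :=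
    (dotProduct_sq_le _ _).trans (mul_le_mul_of_nonneg_left (lap_dotProduct_lap_le ha hD e) hP)
  have hx3 := dotProduct_sq_le p h
  have expand : α ^ 3 * (e ⬝ᵥ (-α • h - β • lap a e - lap a (p - α • e)))
      + p ⬝ᵥ (-α ^ 2 • h - α • lap a p + α ^ 2 • lap a e)
      = -α ^ 4 * (e ⬝ᵥ h) - α ^ 3 * (β - α) * disagreement a e - α ^ 3 * (e ⬝ᵥ lap a p)
        - α ^ 2 * (p ⬝ᵥ h) - α * disagreement a p + α ^ 2 * (p ⬝ᵥ lap a e) := by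
    simp only [lap_sub, lap_smul, dotProduct_sub, dotProduct_add, dotProduct_smul, smul_eq_mul,
      dotProduct_lap_self hbal]
    ring
  rw [expand]
  generalize e ⬝ᵥ e = E at *
  generalize p ⬝ᵥ p = R at *
  generalize h ⬝ᵥ h = H at *
  generalize disagreement a e = s at *
  generalize disagreement a p = sp at *
  generalize e ⬝ᵥ lap a p = x₁ at *
  generalize p ⬝ᵥ lap a e = x₂ at *
  generalize p ⬝ᵥ h = x₃ at *
  generalize e ⬝ᵥ h = y at *
  have hms : 0 ≤ 2 * m * s := by positivity
  -- Young's inequality, weighted so that the condition `6 c₂² ≤ α c₁ l` makes the cost exactly half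
  -- of the damping `α⁴ c₁ E` and one twelfth of `α l R`.
  have t3 : α ^ 2 * |x₃| ≤ α * l / 12 * R + α ^ 4 * c₁ / 2 * E := by
    have h1 := two_mul_abs_le_of_sq_le (c := l / (6 * α)) (by positivity) hP hH hx3
    have h2 : H / (l / (6 * α)) ≤ α ^ 2 * c₁ * E := by
      rw [div_div_eq_mul_div, div_le_iff₀ hl]
      calc H * (6 * α) ≤ c₂ ^ 2 * E * (6 * α) := by gcongr
        _ = (6 * c₂ ^ 2) * (E * α) := by ring
        _ ≤ (α * (c₁ * l)) * (E * α) := by gcongr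
        _ = α ^ 2 * c₁ * E * l := by ring
    calc α ^ 2 * |x₃| = α ^ 2 / 2 * (2 * |x₃|) := by ring
      _ ≤ α ^ 2 / 2 * (l / (6 * α) * R + α ^ 2 * c₁ * E) := by gcongr; linarith
      _ = α * l / 12 * R + α ^ 4 * c₁ / 2 * E := by field_simp; ring
  -- Of the `7 α² m²` in the condition on `β`, one part pays for replacing `β` by `β - α`.
  have hq : 6 * α ^ 2 * m ≤ (β - α) * l := by
    have h2 : α ^ 2 * m * l ≤ α ^ 2 * m * m := by gcongr
    have h3 : α * l * l ≤ α ^ 2 * m * m := by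
      have : α ≤ α ^ 2 := by nlinarith
      gcongr
    have h4 : 6 * α ^ 2 * m * l ≤ (β - α) * l * l := by linarith
    exact le_of_mul_le_mul_right h4 hl
  -- Each of the two Laplacian cross terms costs half of the disagreement damping and one sixth of
  -- `α l R`. With the twelfth from `t3`, less than half of the damping of `p` is used up.
  have t : ∀ x : ℝ, x ^ 2 ≤ R * (2 * m * s) →
      α ^ 3 * |x| ≤ α * l / 6 * R + α ^ 3 * (β - α) / 2 * s := by
    intro x hx
    have h1 := two_mul_abs_le_of_sq_le (c := l / (3 * α ^ 2)) (by positivity) hP hms hx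
    have h2 : 2 * m * s / (l / (3 * α ^ 2)) ≤ (β - α) * s := by
      rw [div_div_eq_mul_div, div_le_iff₀ hl]
      linarith [mul_le_mul_of_nonneg_right hq hs]
    calc α ^ 3 * |x| = α ^ 3 / 2 * (2 * |x|) := by ring
      _ ≤ α ^ 3 / 2 * (l / (3 * α ^ 2) * R + (β - α) * s) := by gcongr; linarith
      _ = _ := by field_simp; ring
  have t1 := t x₁ hx1
  have t2 : α ^ 2 * |x₂| ≤ α * l / 6 * R + α ^ 3 * (β - α) / 2 * s :=
    (mul_le_mul_of_nonneg_right (pow_le_pow_right₀ hα (by norm_num)) (abs_nonneg _)).trans (t x₂ hx2)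
  have a1 : -α ^ 3 * x₁ ≤ α ^ 3 * |x₁| := by
    linarith [mul_le_mul_of_nonneg_left (neg_abs_le x₁) (pow_pos hα0 3).le]
  have a2 : α ^ 2 * x₂ ≤ α ^ 2 * |x₂| := by gcongr; exact le_abs_self _
  have a3 : -α ^ 2 * x₃ ≤ α ^ 2 * |x₃| := by
    linarith [mul_le_mul_of_nonneg_left (neg_abs_le x₃) (pow_pos hα0 2).le]
  have b1 : α ^ 4 * (c₁ * E) ≤ α ^ 4 * y := by gcongr
  have b2 : α * (l * R) ≤ α * sp := by gcongr
  have r1 : 2 * η * (α ^ 3 * E) ≤ α * c₁ * (α ^ 3 * E) := by gcongr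
  have r2 : 2 * η * R ≤ α * l * R := by gcongr
  have r3 : 0 ≤ α * l * R := by positivity
  linarith

theorem two_mul_dotProduct_le {c : ℝ} (hc : 0 < c) (x g : ι → ℝ) :
    2 * (x ⬝ᵥ g) ≤ c * (x ⬝ᵥ x) + (g ⬝ᵥ g) / c := by
  have h := two_mul_abs_le_of_sq_le hc (Finset.sum_nonneg fun i _ => mul_self_nonneg (x i))
    (Finset.sum_nonneg fun i _ => mul_self_nonneg (g i)) (dotProduct_sq_le x g)
  exact le_trans (by gcongr; exact le_abs_self _) h

theorem add_dotProduct_add_le (x y : ι → ℝ) :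
    (x + y) ⬝ᵥ (x + y) ≤ 2 * (x ⬝ᵥ x) + 2 * (y ⬝ᵥ y) := by
  simp only [dotProduct, Finset.mul_sum, ← Finset.sum_add_distrib]
  exact Finset.sum_le_sum fun i _ => by
    simp only [Pi.add_apply]; nlinarith [sq_nonneg (x i - y i)]

/-- The decay of `α³ |e|² + |p|²` along the generator dynamics with sampling errors `ez`, `ev`. -/
theorem generator_decay_of_errors (ha : ∀ i j, 0 ≤ a i j) (hbal : ∀ i, ∑ j, a i j = ∑ j, a j i)
    {l m : ℝ} (hl : 0 < l) (hlm : l ≤ m) (hD : ∀ i, ∑ j, a i j - a i i ≤ m)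
    (hmin : ∀ x : ι → ℝ, ∑ i, x i = 0 → l * (x ⬝ᵥ x) ≤ disagreement a x)
    (hmax : ∀ x, disagreement a x ≤ m * (x ⬝ᵥ x))
    {c₁ c₂ α β η : ℝ} (hη : 0 < η)
    (hα : 1 ≤ α) (hη₁ : 2 * η ≤ α * c₁) (hη₂ : 2 * η ≤ α * l)
    (hα' : 6 * c₂ ^ 2 ≤ α * (c₁ * l)) (hβ : 7 * α ^ 2 * m ^ 2 ≤ β * l ^ 2) :
    ∃ C : ℝ, 0 ≤ C ∧ ∀ e p h ez ev : ι → ℝ, ∑ i, p i = 0 →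
      c₁ * (e ⬝ᵥ e) ≤ e ⬝ᵥ h → h ⬝ᵥ h ≤ c₂ ^ 2 * (e ⬝ᵥ e) →
      2 * (α ^ 3 * (e ⬝ᵥ (-α • h - β • lap a e - lap a (p - α • e) - β • lap a ez - lap a ev))
        + p ⬝ᵥ (-α ^ 2 • h - α • lap a p + α ^ 2 • lap a e - α • lap a ev))
      ≤ -η * (α ^ 3 * (e ⬝ᵥ e) + p ⬝ᵥ p) + C * (ez ⬝ᵥ ez + ev ⬝ᵥ ev) := by
  have hα0 : 0 < α := by linarith
  have hm : 0 ≤ m := by linarith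
  refine ⟨(α ^ 3 * (2 * β ^ 2 + 2) + α ^ 2) * (2 * m ^ 2) / η, by positivity, ?_⟩
  intro e p h ez ev hp heh hh
  have h1 := generator_decay ha hbal hl hlm hD hmin hp heh hh hα hη₁ hη₂ hα' hβ
  have hz := lap_dotProduct_lap_le_sq ha hm hD hmax ez
  have hv := lap_dotProduct_lap_le_sq ha hm hD hmax ev
  have hE : 0 ≤ ez ⬝ᵥ ez := Finset.sum_nonneg fun i _ => mul_self_nonneg _
  have hV : 0 ≤ ev ⬝ᵥ ev := Finset.sum_nonneg fun i _ => mul_self_nonneg _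
  -- Without errors the doubled form decays at the rate `2η`; half of that is spent on the products
  -- with the errors.
  have g1 := two_mul_dotProduct_le hη e (-(β • lap a ez) + -lap a ev)
  have g2 := two_mul_dotProduct_le hη p (-(α • lap a ev))
  have g3 := add_dotProduct_add_le (-(β • lap a ez)) (-lap a ev)
  have s1 : e ⬝ᵥ (-α • h - β • lap a e - lap a (p - α • e) - β • lap a ez - lap a ev)
      = e ⬝ᵥ (-α • h - β • lap a e - lap a (p - α • e))
        + e ⬝ᵥ (-(β • lap a ez) + -lap a ev) := by
    rw [← dotProduct_add]; congr 1; abel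
  have s2 : p ⬝ᵥ (-α ^ 2 • h - α • lap a p + α ^ 2 • lap a e - α • lap a ev)
      = p ⬝ᵥ (-α ^ 2 • h - α • lap a p + α ^ 2 • lap a e) + p ⬝ᵥ (-(α • lap a ev)) := by
    rw [← dotProduct_add]; congr 1
  rw [s1, s2]
  simp only [dotProduct_neg, neg_dotProduct, neg_neg, dotProduct_smul, smul_dotProduct,
    smul_eq_mul, mul_neg] at g1 g2 g3 ⊢
  set X := (-(β • lap a ez) + -lap a ev) ⬝ᵥ (-(β • lap a ez) + -lap a ev)
  have k1 : X ≤ (2 * β ^ 2 + 2) * (2 * m ^ 2) * (ez ⬝ᵥ ez + ev ⬝ᵥ ev) := by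
    have q1 : β ^ 2 * (lap a ez ⬝ᵥ lap a ez) ≤ β ^ 2 * (2 * m ^ 2 * (ez ⬝ᵥ ez)) := by gcongr
    have q2 : 0 ≤ β ^ 2 * (m ^ 2 * (ev ⬝ᵥ ev)) := by positivity
    have q3 : 0 ≤ m ^ 2 * (ez ⬝ᵥ ez) := by positivity
    nlinarith
  have k2 : α * (α * (lap a ev ⬝ᵥ lap a ev)) ≤ α ^ 2 * (2 * m ^ 2) * (ez ⬝ᵥ ez + ev ⬝ᵥ ev) := by
    have q1 : α * (α * (lap a ev ⬝ᵥ lap a ev)) ≤ α * (α * (2 * m ^ 2 * (ev ⬝ᵥ ev))) := by gcongr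
    have q3 : 0 ≤ α ^ 2 * (m ^ 2 * (ez ⬝ᵥ ez)) := by positivity
    nlinarith
  have k3 : α ^ 3 * (X / η) + α * (α * (lap a ev ⬝ᵥ lap a ev)) / η
      ≤ (α ^ 3 * (2 * β ^ 2 + 2) + α ^ 2) * (2 * m ^ 2) / η * (ez ⬝ᵥ ez + ev ⬝ᵥ ev) := by
    rw [← mul_div_assoc, ← add_div, div_mul_eq_mul_div]
    gcongr
    have := mul_le_mul_of_nonneg_left k1 (pow_pos hα0 3).le
    linarith
  have k4 := mul_le_mul_of_nonneg_left g1 (pow_pos hα0 3).le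
  linarith

end StaticEstimates

/-! ### A scalar comparison principle -/

section Comparison

/-- A right differentiable function with `V' ≤ -r V + A + B exp (-2γt)`, where `2γ < r`, approaches
`A / r` at least at the rate `2γ`. -/
theorem le_of_deriv_right_le {T : EReal} {V V' : ℝ → ℝ} {r A B γ : ℝ}
    (hc : ContinuousOn V {t : ℝ | 0 ≤ t ∧ (t : EReal) < T})
    (hd : ∀ t : ℝ, 0 ≤ t → (t : EReal) < T → HasDerivWithinAt V (V' t) (Ici t) t)
    (hr : 0 < r) (hγ : 2 * γ < r) (hA : 0 ≤ A) (hB : 0 ≤ B)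
    (hb : ∀ t : ℝ, 0 ≤ t → (t : EReal) < T →
      V' t ≤ -r * V t + (A + B * Real.exp (-(2 * γ) * t)))
    (t : ℝ) (ht : 0 ≤ t) (htT : (t : EReal) < T) :
    V t ≤ A / r + (|V 0| + B / (r - 2 * γ)) * Real.exp (-(2 * γ) * t) := by
  have hrγ : 0 < r - 2 * γ := by linarith
  have hsub : ∀ s ∈ Icc 0 t, (s : EReal) < T := fun s hs =>
    (EReal.coe_le_coe_iff.mpr hs.2).trans_lt htT
  have hexp : ∀ c s : ℝ, HasDerivAt (fun s => Real.exp (c * s)) (c * Real.exp (c * s)) s := by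
    intro c s
    simpa [mul_comm] using ((hasDerivAt_id s).const_mul c).exp
  have key := image_le_of_deriv_right_le_deriv_boundary
    (f := fun s => Real.exp (r * s) * V s)
    (f' := fun s => r * Real.exp (r * s) * V s + Real.exp (r * s) * V' s) (a := 0) (b := t)
    (B := fun s => |V 0| + A / r * Real.exp (r * s)
      + B / (r - 2 * γ) * Real.exp ((r - 2 * γ) * s))
    (B' := fun s => A / r * (r * Real.exp (r * s))
      + B / (r - 2 * γ) * ((r - 2 * γ) * Real.exp ((r - 2 * γ) * s)))
    ((by fun_prop : Continuous fun s => Real.exp (r * s)).continuousOn.mul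
      (hc.mono fun s hs => ⟨hs.1, hsub s hs⟩))
    (fun s hs => (hexp r s).hasDerivWithinAt.mul (hd s hs.1 (hsub s ⟨hs.1, hs.2.le⟩)))
    (by
      simp only [mul_zero, Real.exp_zero, one_mul, mul_one]
      have : 0 ≤ A / r := by positivity
      have : 0 ≤ B / (r - 2 * γ) := by positivity
      linarith [le_abs_self (V 0)])
    (by fun_prop)
    (fun s _ => ((((hexp r s).const_mul (A / r)).const_add _).add
      ((hexp (r - 2 * γ) s).const_mul _)).hasDerivWithinAt)
    (fun s hs => by
      have h1 := hb s hs.1 (hsub s ⟨hs.1, hs.2.le⟩)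
      have h2 : Real.exp ((r - 2 * γ) * s) = Real.exp (r * s) * Real.exp (-(2 * γ) * s) := by
        rw [← Real.exp_add]; congr 1; ring
      have h3 : A / r * (r * Real.exp (r * s))
          + B / (r - 2 * γ) * ((r - 2 * γ) * Real.exp ((r - 2 * γ) * s))
          = Real.exp (r * s) * (A + B * Real.exp (-(2 * γ) * s)) := by
        rw [h2]; field_simp
      rw [h3]
      have := mul_le_mul_of_nonneg_left h1 (Real.exp_pos (r * s)).le
      linarith)
    (⟨ht, le_rfl⟩ : t ∈ Icc 0 t)
  have hpos := Real.exp_pos (r * t)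
  -- The initial value decays at the faster rate `r`; this weakens it to `2γ`, so that one
  -- exponential covers both transients.
  have h0 : (1 : ℝ) ≤ Real.exp (r * t) * Real.exp (-(2 * γ) * t) := by
    rw [← Real.exp_add]
    exact Real.one_le_exp (by nlinarith)
  have h2 : Real.exp ((r - 2 * γ) * t) = Real.exp (r * t) * Real.exp (-(2 * γ) * t) := by
    rw [← Real.exp_add]; congr 1; ring
  simp only [h2] at key
  refine le_of_mul_le_mul_left ?_ hpos
  have := mul_le_mul_of_nonneg_left h0 (abs_nonneg (V 0))
  linarith

end Comparison

/-! ### Growth of signals relative to the threshold -/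

section Thresholds

variable {c₀ c₁ γ : ℝ}

theorem threshold_pos (h₀ : 0 ≤ c₀) (h₁ : 0 ≤ c₁) (h : 0 < c₀ + c₁) (t : ℝ) :
    0 < threshold c₀ c₁ γ t := by
  unfold threshold
  rcases h₀.eq_or_lt with h0 | h0
  · have : 0 < c₁ := by linarith
    rw [← h0]; positivity
  · positivity

theorem threshold_sq_le (t : ℝ) :
    threshold c₀ c₁ γ t ^ 2 ≤ 2 * c₀ ^ 2 + 2 * c₁ ^ 2 * Real.exp (-(2 * γ) * t) := by
  have h : Real.exp (-(2 * γ) * t) = Real.exp (-γ * t) ^ 2 := by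
    rw [← Real.exp_nat_mul]; congr 1; push_cast; ring
  rw [h, threshold]
  nlinarith [sq_nonneg (c₀ - c₁ * Real.exp (-γ * t))]

/-- Both `c₀` and `(c₀ + c₁) exp (-γt)` lie below the threshold, so it dominates up to a constant
any quantity with the same floor and rate. This covers `c₀ = 0`, where the threshold tends to zero.
-/
theorem exists_le_mul_threshold (h₀ : 0 ≤ c₀) (h₁ : 0 ≤ c₁) (h : 0 < c₀ + c₁) (hγ : 0 ≤ γ)
    {κ M : ℝ} (hκ : 0 ≤ κ) (hM : 0 ≤ M) :
    ∃ M' : ℝ, 0 ≤ M' ∧ ∀ t x : ℝ, 0 ≤ t →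
      x ^ 2 ≤ κ * c₀ ^ 2 + M * Real.exp (-(2 * γ) * t) → |x| ≤ M' * threshold c₀ c₁ γ t := by
  refine ⟨√(κ + M / (c₀ + c₁) ^ 2), Real.sqrt_nonneg _, fun t x ht hx => ?_⟩
  have hθ := threshold_pos (γ := γ) h₀ h₁ h t
  refine abs_le_of_sq_le_sq (hx.trans ?_) (by positivity)
  rw [mul_pow, Real.sq_sqrt (by positivity), add_mul]
  have hexp : Real.exp (-(2 * γ) * t) = Real.exp (-γ * t) ^ 2 := by
    rw [← Real.exp_nat_mul]; congr 1; push_cast; ring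
  have h1 : c₀ ≤ threshold c₀ c₁ γ t := by
    unfold threshold; linarith [mul_nonneg h₁ (Real.exp_pos (-γ * t)).le]
  have h2 : (c₀ + c₁) * Real.exp (-γ * t) ≤ threshold c₀ c₁ γ t := by
    have : Real.exp (-γ * t) ≤ 1 := Real.exp_le_one_iff.mpr (by nlinarith)
    unfold threshold
    nlinarith
  have h3 : M * Real.exp (-(2 * γ) * t)
      = M / (c₀ + c₁) ^ 2 * ((c₀ + c₁) * Real.exp (-γ * t)) ^ 2 := by
    rw [hexp]; field_simp
  rw [h3]
  gcongr

theorem threshold_le_of_le (h₁ : 0 ≤ c₁) (hγ : 0 ≤ γ) {s t : ℝ} (hst : s ≤ t) :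
    threshold c₀ c₁ γ t ≤ threshold c₀ c₁ γ s := by
  unfold threshold
  gcongr c₀ + c₁ * Real.exp ?_
  nlinarith

/-- The relative decay rate of the threshold is at most `γ ≤ 1`. -/
theorem one_sub_mul_threshold_le (h₀ : 0 ≤ c₀) (h₁ : 0 ≤ c₁) (hγ : γ ≤ 1) {s t : ℝ}
    (hst : s ≤ t) : (1 - (t - s)) * threshold c₀ c₁ γ s ≤ threshold c₀ c₁ γ t := by
  have h1 : Real.exp (-γ * t) = Real.exp (-γ * (t - s)) * Real.exp (-γ * s) := by
    rw [← Real.exp_add]; congr 1; ring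
  have h2 : 1 - (t - s) ≤ Real.exp (-γ * (t - s)) := by
    have := Real.add_one_le_exp (-γ * (t - s))
    nlinarith
  unfold threshold
  rw [h1]
  have h3 := mul_le_mul_of_nonneg_right h2 (mul_nonneg h₁ (Real.exp_pos (-γ * s)).le)
  nlinarith

/-- If the derivative of `φ` is bounded by a multiple of the threshold, then so is its increment
over a short time. -/
theorem abs_sub_le_of_deriv_le_threshold (h₁ : 0 ≤ c₁) (hγ : 0 ≤ γ) {T : EReal} {φ φ' : ℝ → ℝ}
    (hc : ContinuousOn φ {t : ℝ | 0 ≤ t ∧ (t : EReal) < T})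
    (hd : ∀ t : ℝ, 0 ≤ t → (t : EReal) < T → HasDerivWithinAt φ (φ' t) (Ici t) t)
    {M : ℝ} (hM : 0 ≤ M)
    (hb : ∀ t : ℝ, 0 ≤ t → (t : EReal) < T → |φ' t| ≤ M * threshold c₀ c₁ γ t)
    {s t : ℝ} (hs : 0 ≤ s) (hst : s ≤ t) (htT : (t : EReal) < T) :
    |φ t - φ s| ≤ M * threshold c₀ c₁ γ s * (t - s) := by
  have hsub : ∀ r ∈ Icc s t, 0 ≤ r ∧ (r : EReal) < T := fun r hr =>
    ⟨hs.trans hr.1, (EReal.coe_le_coe_iff.mpr hr.2).trans_lt htT⟩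
  exact norm_image_sub_le_of_norm_deriv_right_le_segment (hc.mono hsub)
    (fun r hr => hd r (hsub r ⟨hr.1, hr.2.le⟩).1 (hsub r ⟨hr.1, hr.2.le⟩).2)
    (fun r hr => (hb r (hsub r ⟨hr.1, hr.2.le⟩).1 (hsub r ⟨hr.1, hr.2.le⟩).2).trans
      (mul_le_mul_of_nonneg_left (threshold_le_of_le h₁ hγ hr.1) hM))
    t ⟨hst, le_rfl⟩

end Thresholds

/-! ### Event times -/

section Events

variable {T : EReal} {ev : ℕ → EReal} {θ : ℝ → ℝ} {err : ℝ → ℝ → ℝ}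

theorem event_time_real (hT : 0 < T) (h0 : ev 0 = 0)
    (hsucc : ∀ k, ev (k + 1) = sInf (Real.toEReal '' {t : ℝ | ev k < (t : EReal) ∧
      (t : EReal) < T ∧ θ t ≤ err (ev k).toReal t})) (k : ℕ) (hk : ev k ≠ ⊤) :
    ∃ s : ℝ, 0 ≤ s ∧ (s : EReal) < T ∧ ev k = s := by
  induction k with
  | zero => exact ⟨0, le_rfl, by simpa using hT, by simpa using h0⟩
  | succ k ih =>
    have hne : (Real.toEReal '' {t : ℝ | ev k < (t : EReal) ∧
        (t : EReal) < T ∧ θ t ≤ err (ev k).toReal t}).Nonempty := by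
      by_contra h
      rw [not_nonempty_iff_eq_empty] at h
      exact hk (by rw [hsucc, h, sInf_empty])
    obtain ⟨_, t, ⟨ht, htT, hθ⟩, rfl⟩ := hne
    obtain ⟨s, hs, hsT, hks⟩ := ih (ne_top_of_lt ht)
    have hle : ev (k + 1) ≤ t := by
      rw [hsucc]; exact sInf_le ⟨t, ⟨ht, htT, hθ⟩, rfl⟩
    have hge : (s : EReal) ≤ ev (k + 1) := by
      rw [hsucc, ← hks]
      refine le_sInf ?_
      rintro _ ⟨r, hr, rfl⟩
      exact hr.1.le
    have hbot : ev (k + 1) ≠ ⊥ := fun h => by rw [h] at hge; simp at hge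
    refine ⟨(ev (k + 1)).toReal, ?_, ?_, (EReal.coe_toReal hk hbot).symm⟩
    · rw [← EReal.coe_le_coe_iff, EReal.coe_toReal hk hbot]
      exact (EReal.coe_le_coe_iff.mpr hs).trans hge
    · rw [EReal.coe_toReal hk hbot]
      exact hle.trans_lt htT

/-- If the error exceeded the threshold at a time after the event, the infimum defining the next
event would be no later. At the event itself the error is zero. -/
theorem err_le_of_hold
    (hsucc : ∀ k, ev (k + 1) = sInf (Real.toEReal '' {t : ℝ | ev k < (t : EReal) ∧
      (t : EReal) < T ∧ θ t ≤ err (ev k).toReal t}))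
    (hθ : ∀ t, 0 ≤ θ t) (herr : ∀ t, err t t = 0) {k : ℕ} {t : ℝ} (htT : (t : EReal) < T)
    (hk : ev k ≤ t) (hk' : (t : EReal) < ev (k + 1)) : err (ev k).toReal t ≤ θ t := by
  rcases hk.eq_or_lt with h | h
  · rw [h, EReal.toReal_coe, herr]; exact hθ t
  · by_contra! hlt
    rw [hsucc] at hk'
    exact hk'.not_ge (sInf_le ⟨t, ⟨h, htT, hlt.le⟩, rfl⟩)

/-- Excluding triggers for a time `2τ` leaves room for a strict inequality with `τ` after passing to
the infimum, including the infimum `⊤` of the empty set. -/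
theorem add_lt_next_event (hT : 0 < T) (h0 : ev 0 = 0)
    (hsucc : ∀ k, ev (k + 1) = sInf (Real.toEReal '' {t : ℝ | ev k < (t : EReal) ∧
      (t : EReal) < T ∧ θ t ≤ err (ev k).toReal t}))
    {τ : ℝ} (hτ : 0 < τ)
    (hslow : ∀ s t : ℝ, 0 ≤ s → s ≤ t → (t : EReal) < T → t ≤ s + 2 * τ → err s t < θ t)
    {k : ℕ} (hk : ev k ≠ ⊤) : ev k + (τ : EReal) < ev (k + 1) := by
  obtain ⟨s, hs, hsT, hks⟩ := event_time_real hT h0 hsucc k hk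
  rw [hsucc, hks, ← EReal.coe_add]
  refine (EReal.coe_lt_coe_iff.mpr (by linarith : s + τ < s + 2 * τ)).trans_le (le_sInf ?_)
  rintro _ ⟨t, ⟨hst, htT, hle⟩, rfl⟩
  rw [EReal.coe_le_coe_iff]
  by_contra! hlt
  rw [EReal.toReal_coe] at hle
  exact (hslow s t hs (EReal.coe_lt_coe_iff.mp hst).le htT hlt.le).not_ge hle

end Events

/-! ### Differentiation of dot products -/

section Derivatives

variable {ι : Type*} [Fintype ι]

theorem HasDerivWithinAt.dotProduct {x y : ℝ → ι → ℝ} {x' y' : ι → ℝ} {s : Set ℝ} {t : ℝ}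
    (hx : HasDerivWithinAt x x' s t) (hy : HasDerivWithinAt y y' s t) :
    HasDerivWithinAt (fun t => x t ⬝ᵥ y t) (x' ⬝ᵥ y t + x t ⬝ᵥ y') s t := by
  rw [hasDerivWithinAt_pi] at hx hy
  have h := HasDerivWithinAt.fun_sum (u := Finset.univ) fun i _ => (hx i).mul (hy i)
  simpa only [_root_.dotProduct, ← Finset.sum_add_distrib] using! h

theorem HasDerivWithinAt.mulVec {m : Type*} [Fintype m] (M : Matrix m ι ℝ) {x : ℝ → ι → ℝ}
    {x' : ι → ℝ} {s : Set ℝ} {t : ℝ} (hx : HasDerivWithinAt x x' s t) :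
    HasDerivWithinAt (fun t => M *ᵥ x t) (M *ᵥ x') s t := by
  rw [hasDerivWithinAt_pi]
  intro i
  have h := (hasDerivWithinAt_const t s (M i)).dotProduct hx
  simpa [Matrix.mulVec] using! h

theorem ContinuousOn.dotProduct' {x y : ℝ → ι → ℝ} {s : Set ℝ} (hx : ContinuousOn x s)
    (hy : ContinuousOn y s) : ContinuousOn (fun t => x t ⬝ᵥ y t) s := by
  rw [continuousOn_pi] at hx hy
  exact continuousOn_finsetSum _ fun i _ => (hx i).mul (hy i)

theorem sq_le_dotProduct_self (x : ι → ℝ) (i : ι) : x i ^ 2 ≤ x ⬝ᵥ x := by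
  rw [sq]
  exact Finset.single_le_sum (f := fun i => x i * x i) (fun i _ => mul_self_nonneg _)
    (Finset.mem_univ i)

end Derivatives

/-! ### Bounds along trajectories of the agents and generators -/

/-- A Hurwitz linear system with an input `g` satisfying `g² ≤ A + B exp (-2γt)` enters at the rate
`γ` a ball whose squared radius is proportional to `A`. -/
theorem linear_system_bound {n : ℕ} {F Q : Matrix (Fin n) (Fin n) ℝ} (b : Fin n → ℝ)
    (hQ : Q.PosDef) (hLyap : Fᵀ * Q + Q * F = -((2 : ℝ) • 1)) :
    ∃ κ : ℝ, 0 ≤ κ ∧ ∀ (T : EReal) (γ A B : ℝ) (ζ : ℝ → Fin n → ℝ) (g : ℝ → ℝ),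
      0 < γ → γ < 1 / (2 * maxEigenvalue Q) → 0 ≤ A → 0 ≤ B →
      ContinuousOn ζ {t : ℝ | 0 ≤ t ∧ (t : EReal) < T} →
      (∀ t : ℝ, 0 ≤ t → (t : EReal) < T →
        HasDerivWithinAt ζ (F *ᵥ ζ t + g t • b) (Ici t) t) →
      (∀ t : ℝ, 0 ≤ t → (t : EReal) < T → g t ^ 2 ≤ A + B * Real.exp (-(2 * γ) * t)) →
      ∃ M : ℝ, 0 ≤ M ∧ ∀ t : ℝ, 0 ≤ t → (t : EReal) < T →
        ζ t ⬝ᵥ ζ t ≤ κ * A + M * Real.exp (-(2 * γ) * t) := by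
  rcases isEmpty_or_nonempty (Fin n) with hn | hn
  · refine ⟨0, le_rfl, fun T γ A B ζ g _ _ _ _ _ _ _ => ⟨0, le_rfl, fun t _ _ => ?_⟩⟩
    simp [dotProduct]
  obtain ⟨m, hm, hmQ⟩ := hQ.exists_mul_dotProduct_le
  set lm := maxEigenvalue Q with hlm
  set k := (Q *ᵥ b) ⬝ᵥ (Q *ᵥ b) with hk
  have hk0 : 0 ≤ k := Finset.sum_nonneg fun i _ => mul_self_nonneg _
  -- The sign of `lm` is read off only below, from `0 < γ < 1 / (2 * lm)`; the absolute value makes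
  -- the constant nonnegative beforehand.
  refine ⟨k * |lm| / m, by positivity, ?_⟩
  intro T γ A B ζ g hγ hγl hA hB hc hd hg
  have hlm0 : 0 < lm := by
    have h : 0 < 1 / (2 * lm) := hγ.trans hγl
    rw [one_div, inv_pos] at h
    linarith
  have hr : 0 < 1 / lm := by positivity
  have h2γ : 2 * γ < 1 / lm := by
    have : 1 / lm = 2 * (1 / (2 * lm)) := by field_simp
    linarith
  have hsymm : Qᵀ = Q := by
    simpa [IsHermitian, conjTranspose_eq_transpose_of_trivial] using hQ.isHermitian
  have hsym : ∀ x y : Fin n → ℝ, x ⬝ᵥ Q *ᵥ y = y ⬝ᵥ Q *ᵥ x := by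
    intro x y
    rw [dotProduct_comm y, dotProduct_mulVec, ← mulVec_transpose, hsymm]
  have hlyap : ∀ x : Fin n → ℝ, 2 * (x ⬝ᵥ Q *ᵥ (F *ᵥ x)) = -2 * (x ⬝ᵥ x) := by
    intro x
    have h1 : x ⬝ᵥ (Fᵀ * Q + Q * F) *ᵥ x = -2 * (x ⬝ᵥ x) := by
      rw [hLyap]; simp [neg_mulVec, smul_mulVec]
    have h2 : x ⬝ᵥ (Fᵀ * Q) *ᵥ x = x ⬝ᵥ (Q * F) *ᵥ x := by
      rw [← mulVec_mulVec, ← mulVec_mulVec, hsym x, mulVec_transpose, dotProduct_comm x,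
        ← dotProduct_mulVec, dotProduct_comm]
    rw [add_mulVec, dotProduct_add, h2, ← mulVec_mulVec] at h1
    linarith
  have hVd : ∀ t : ℝ, 0 ≤ t → (t : EReal) < T →
      HasDerivWithinAt (fun t => ζ t ⬝ᵥ Q *ᵥ ζ t)
        (-2 * (ζ t ⬝ᵥ ζ t) + 2 * (ζ t ⬝ᵥ (g t • (Q *ᵥ b)))) (Ici t) t := by
    intro t ht htT
    convert (hd t ht htT).dotProduct ((hd t ht htT).mulVec Q) using 1
    rw [hsym _ (ζ t), mulVec_add, dotProduct_add, mulVec_smul, ← hlyap]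
    ring
  have hVc : ContinuousOn (fun t => ζ t ⬝ᵥ Q *ᵥ ζ t) {t : ℝ | 0 ≤ t ∧ (t : EReal) < T} :=
    hc.dotProduct' ((by fun_prop : Continuous fun x : Fin n → ℝ => Q *ᵥ x).comp_continuousOn hc)
  -- Of the decay `-2 |ζ|²`, one half absorbs the input and the other is at most `-V / lm`.
  have key := le_of_deriv_right_le hVc hVd hr h2γ (A := k * A) (B := k * B) (by positivity)
    (by positivity) (fun t ht htT => by
      have h1 := two_mul_dotProduct_le one_pos (ζ t) (g t • (Q *ᵥ b))
      have h2 := dotProduct_mulVec_le_maxEigenvalue hQ.isHermitian (ζ t)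
      have h3 : 1 / lm * (ζ t ⬝ᵥ Q *ᵥ ζ t) ≤ ζ t ⬝ᵥ ζ t := by
        rw [one_div, inv_mul_le_iff₀ hlm0]; exact h2
      have h4 : (g t • (Q *ᵥ b)) ⬝ᵥ (g t • (Q *ᵥ b)) = k * g t ^ 2 := by
        simp only [smul_dotProduct, dotProduct_smul, smul_eq_mul, hk]; ring
      have h5 := mul_le_mul_of_nonneg_left (hg t ht htT) hk0
      rw [h4] at h1
      linarith)
  refine ⟨(|ζ 0 ⬝ᵥ Q *ᵥ ζ 0| + k * B / (1 / lm - 2 * γ)) / m, ?_, fun t ht htT => ?_⟩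
  · have : 0 < 1 / lm - 2 * γ := by linarith
    positivity
  · have h1 := (hmQ (ζ t)).trans (key t ht htT)
    rw [mul_comm, ← le_div_iff₀ hm] at h1
    refine h1.trans (le_of_eq ?_)
    rw [abs_of_pos hlm0]
    field_simp

/-- The signal generators approach the minimizer, and their derivatives are bounded accordingly. -/
theorem generator_bound {ι : Type*} [Fintype ι] [Nonempty ι] {a : ι → ι → ℝ}
    (ha : ∀ i j, 0 ≤ a i j) (hbal : ∀ i, ∑ j, a i j = ∑ j, a j i)
    {l m : ℝ} (hl : 0 < l) (hlm : l ≤ m) (hD : ∀ i, ∑ j, a i j - a i i ≤ m)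
    (hmin : ∀ x : ι → ℝ, ∑ i, x i = 0 → l * (x ⬝ᵥ x) ≤ disagreement a x)
    (hmax : ∀ x, disagreement a x ≤ m * (x ⬝ᵥ x))
    {c₁ c₂ α β η : ℝ} (hη : 0 < η)
    (hα : 1 ≤ α) (hη₁ : 2 * η ≤ α * c₁) (hη₂ : 2 * η ≤ α * l)
    (hα' : 6 * c₂ ^ 2 ≤ α * (c₁ * l)) (hβ : 7 * α ^ 2 * m ^ 2 ≤ β * l ^ 2)
    {g : ι → ℝ → ℝ} {y : ℝ} (hy : ∑ i, g i y = 0)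
    (hg₁ : ∀ i s, c₁ * (s - y) ^ 2 ≤ (s - y) * (g i s - g i y))
    (hg₂ : ∀ i s, (g i s - g i y) ^ 2 ≤ c₂ ^ 2 * (s - y) ^ 2) :
    ∃ κ : ℝ, 0 ≤ κ ∧ ∀ (T : EReal) (d₀ d₁ δ : ℝ) (z v zt vt : ι → ℝ → ℝ),
      0 ≤ δ → 2 * δ < η →
      (∀ i, ContinuousOn (z i) {t : ℝ | 0 ≤ t ∧ (t : EReal) < T}) →
      (∀ i, ContinuousOn (v i) {t : ℝ | 0 ≤ t ∧ (t : EReal) < T}) →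
      (∀ i (t : ℝ), 0 ≤ t → (t : EReal) < T → HasDerivWithinAt (z i)
        (-α * g i (z i t) - β * ∑ j, a i j * (zt i t - zt j t)
          - ∑ j, a i j * (vt i t - vt j t)) (Ici t) t) →
      (∀ i (t : ℝ), 0 ≤ t → (t : EReal) < T → HasDerivWithinAt (v i)
        (α * β * ∑ j, a i j * (zt i t - zt j t)) (Ici t) t) →
      (∀ i (t : ℝ), 0 ≤ t → (t : EReal) < T →
        (zt i t - z i t) ^ 2 + (vt i t - v i t) ^ 2 ≤ threshold d₀ d₁ δ t ^ 2) →
      ∃ M : ℝ, 0 ≤ M ∧ ∀ t : ℝ, 0 ≤ t → (t : EReal) < T → ∀ i,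
        (z i t - y) ^ 2 ≤ κ * d₀ ^ 2 + M * Real.exp (-(2 * δ) * t) ∧
        (-α * g i (z i t) - β * ∑ j, a i j * (zt i t - zt j t)
          - ∑ j, a i j * (vt i t - vt j t)) ^ 2 ≤ κ * d₀ ^ 2 + M * Real.exp (-(2 * δ) * t) ∧
        (α * β * ∑ j, a i j * (zt i t - zt j t)) ^ 2
          ≤ κ * d₀ ^ 2 + M * Real.exp (-(2 * δ) * t) := by
  have hα0 : 0 < α := by linarith
  have hm0 : 0 ≤ m := by linarith
  obtain ⟨C, hC, hdecay⟩ := generator_decay_of_errors ha hbal hl hlm hD hmin hmax hη hα hη₁ hη₂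
    hα' hβ
  obtain ⟨v₀, hv₀⟩ := exists_lap_eq hbal hl ha hmin (g := fun i => -α * g i y)
    (by rw [← Finset.mul_sum, hy, mul_zero])
  set n : ℝ := (Fintype.card ι : ℝ) with hn
  have hn0 : 0 < n := by rw [hn]; exact_mod_cast Fintype.card_pos
  set k₀ := 2 * C * n / η + 2 * n with hk₀
  -- The three summands serve the bounds on `z - y`, on `z'` (six squares) and on `v'`, so that one
  -- constant works for all.
  set K := 1 + 6 * (α ^ 2 * c₂ ^ 2 + (2 * β ^ 2 + α ^ 2 + 2) * (2 * m ^ 2))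
    + 4 * (α ^ 2 * β ^ 2) * (2 * m ^ 2) with hK
  have hk₀0 : 0 ≤ k₀ := by positivity
  have hK1 : 1 ≤ K := by
    rw [hK, add_assoc]; exact le_add_of_nonneg_right (by positivity)
  refine ⟨K * k₀, by positivity, ?_⟩
  intro T d₀ d₁ δ z v zt vt hδ hδη hzc hvc hzd hvd hhold
  let e : ℝ → ι → ℝ := fun t i => z i t - y
  -- The combination `v + α z` is chosen so that `β` drops out of its derivative; see `hqd_eq`.
  -- Removing the mean gives `p`, to which the spectral gap applies, and is invisible to the
  -- Laplacian.
  let q : ℝ → ι → ℝ := fun t i => v i t - v₀ i + α * (z i t - y)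
  let p : ℝ → ι → ℝ := fun t i => q t i - (∑ j, q t j) / n
  let h : ℝ → ι → ℝ := fun t i => g i (z i t) - g i y
  let ez : ℝ → ι → ℝ := fun t i => zt i t - z i t
  let ev : ℝ → ι → ℝ := fun t i => vt i t - v i t
  let zd : ℝ → ι → ℝ := fun t => -α • h t - β • lap a (e t) - lap a (p t - α • e t)
    - β • lap a (ez t) - lap a (ev t)
  let vd : ℝ → ι → ℝ := fun t => (α * β) • (lap a (e t) + lap a (ez t))
  let qd : ℝ → ι → ℝ := fun t => -α ^ 2 • h t - α • lap a (p t) + α ^ 2 • lap a (e t)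
    - α • lap a (ev t)
  have hzt : ∀ t, lap a (fun i => zt i t) = lap a (e t) + lap a (ez t) := by
    intro t
    rw [← lap_add]
    have : (fun i => zt i t) = (e t + ez t) + fun _ => y := by
      funext i; simp only [e, ez, Pi.add_apply]; ring
    rw [this, lap_add _ (fun _ => y), lap_const, add_zero]
  have hvt : ∀ t, lap a (fun i => vt i t)
      = lap a (p t - α • e t) + lap a (ev t) + fun i => -α * g i y := by
    intro t
    rw [← hv₀, ← lap_add, ← lap_add]
    have : (fun i => vt i t) = (p t - α • e t + ev t + v₀) + fun _ => (∑ j, q t j) / n := by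
      funext i
      simp only [p, q, e, ev, Pi.add_apply, Pi.sub_apply, Pi.smul_apply, smul_eq_mul]; ring
    rw [this, lap_add _ (fun _ => (∑ j, q t j) / n), lap_const, add_zero]
  have hzd_eq : ∀ t i, -α * g i (z i t) - β * ∑ j, a i j * (zt i t - zt j t)
      - ∑ j, a i j * (vt i t - vt j t) = zd t i := by
    intro t i
    have h1 := congrFun (hzt t) i
    have h2 := congrFun (hvt t) i
    simp only [lap, Pi.add_apply] at h1 h2
    rw [h1, h2]
    simp only [zd, h, lap, Pi.sub_apply, Pi.smul_apply, smul_eq_mul]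
    ring
  have hvd_eq : ∀ t i, α * β * ∑ j, a i j * (zt i t - zt j t) = vd t i := by
    intro t i
    have h1 := congrFun (hzt t) i
    simp only [lap, Pi.add_apply] at h1
    rw [h1]; rfl
  have hqd_eq : ∀ t i, vd t i + α * zd t i = qd t i := by
    intro t i
    simp only [vd, zd, qd, lap_sub, lap_smul, Pi.add_apply, Pi.sub_apply, Pi.smul_apply,
      smul_eq_mul]
    ring
  simp only [hzd_eq, hvd_eq] at hzd hvd ⊢
  have hpsum : ∀ t, ∑ i, p t i = 0 := by
    intro t
    simp only [p, Finset.sum_sub_distrib, Finset.sum_const, Finset.card_univ, nsmul_eq_mul, ← hn]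
    field_simp; ring
  have hed : ∀ t : ℝ, 0 ≤ t → (t : EReal) < T → HasDerivWithinAt e (zd t) (Ici t) t :=
    fun t ht htT => hasDerivWithinAt_pi.mpr fun i => (hzd i t ht htT).sub_const y
  have hqd : ∀ t : ℝ, 0 ≤ t → (t : EReal) < T → HasDerivWithinAt q (qd t) (Ici t) t :=
    fun t ht htT => hasDerivWithinAt_pi.mpr fun i => by
      rw [← hqd_eq]
      exact ((hvd i t ht htT).sub_const _).add (((hzd i t ht htT).sub_const y).const_mul α)
  have hpd : ∀ t : ℝ, 0 ≤ t → (t : EReal) < T →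
      HasDerivWithinAt p (fun i => qd t i - (∑ j, qd t j) / n) (Ici t) t :=
    fun t ht htT => hasDerivWithinAt_pi.mpr fun i => by
      have h1 := hasDerivWithinAt_pi.mp (hqd t ht htT)
      exact (h1 i).sub ((HasDerivWithinAt.fun_sum fun j _ => h1 j).div_const n)
  have hec : ContinuousOn e {t : ℝ | 0 ≤ t ∧ (t : EReal) < T} :=
    continuousOn_pi.mpr fun i => (hzc i).sub continuousOn_const
  have hqc : ∀ i, ContinuousOn (fun t => q t i) {t : ℝ | 0 ≤ t ∧ (t : EReal) < T} := fun i =>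
    ((hvc i).sub continuousOn_const).add
      (continuousOn_const.mul ((hzc i).sub continuousOn_const))
  have hpc : ContinuousOn p {t : ℝ | 0 ≤ t ∧ (t : EReal) < T} :=
    continuousOn_pi.mpr fun i => (hqc i).sub
      ((continuousOn_finsetSum _ fun j _ => hqc j).div_const n)
  let V : ℝ → ℝ := fun t => α ^ 3 * (e t ⬝ᵥ e t) + p t ⬝ᵥ p t
  have hVd : ∀ t : ℝ, 0 ≤ t → (t : EReal) < T → HasDerivWithinAt V
      (2 * (α ^ 3 * (e t ⬝ᵥ zd t) + p t ⬝ᵥ qd t)) (Ici t) t := by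
    intro t ht htT
    refine ((((hed t ht htT).dotProduct (hed t ht htT)).const_mul (α ^ 3)).add
      ((hpd t ht htT).dotProduct (hpd t ht htT))).congr_deriv ?_
    -- The mean of `q'` drops out because `p` has mean zero.
    have h1 : p t ⬝ᵥ (fun i => qd t i - (∑ j, qd t j) / n) = p t ⬝ᵥ qd t := by
      simp only [dotProduct, mul_sub, Finset.sum_sub_distrib, ← Finset.sum_mul, hpsum, zero_mul,
        sub_zero]
    rw [dotProduct_comm (zd t), dotProduct_comm _ (p t), h1]
    ring
  have hVc : ContinuousOn V {t : ℝ | 0 ≤ t ∧ (t : EReal) < T} :=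
    (continuousOn_const.mul (hec.dotProduct' hec)).add (hpc.dotProduct' hpc)
  have herr : ∀ t : ℝ, 0 ≤ t → (t : EReal) < T → ez t ⬝ᵥ ez t + ev t ⬝ᵥ ev t
      ≤ 2 * n * d₀ ^ 2 + 2 * n * d₁ ^ 2 * Real.exp (-(2 * δ) * t) := by
    intro t ht htT
    calc ez t ⬝ᵥ ez t + ev t ⬝ᵥ ev t
        = ∑ i, ((zt i t - z i t) ^ 2 + (vt i t - v i t) ^ 2) := by
          simp only [dotProduct, ez, ev, ← Finset.sum_add_distrib, sq]
      _ ≤ ∑ _i : ι, threshold d₀ d₁ δ t ^ 2 := Finset.sum_le_sum fun i _ => hhold i t ht htT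
      _ = n * threshold d₀ d₁ δ t ^ 2 := by simp [hn]
      _ ≤ n * (2 * d₀ ^ 2 + 2 * d₁ ^ 2 * Real.exp (-(2 * δ) * t)) := by
          gcongr; exact threshold_sq_le t
      _ = _ := by ring
  have heh : ∀ t, c₁ * (e t ⬝ᵥ e t) ≤ e t ⬝ᵥ h t := by
    intro t
    simp only [dotProduct, Finset.mul_sum, ← sq]
    exact Finset.sum_le_sum fun i _ => hg₁ i _
  have hhh : ∀ t, h t ⬝ᵥ h t ≤ c₂ ^ 2 * (e t ⬝ᵥ e t) := by
    intro t
    simp only [dotProduct, Finset.mul_sum, ← sq]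
    exact Finset.sum_le_sum fun i _ => hg₂ i _
  have key := le_of_deriv_right_le hVc hVd hη hδη (A := C * (2 * n * d₀ ^ 2))
    (B := C * (2 * n * d₁ ^ 2)) (by positivity) (by positivity) (fun t ht htT => by
      have h1 := hdecay (e t) (p t) (h t) (ez t) (ev t) (hpsum t) (heh t) (hhh t)
      have h2 := mul_le_mul_of_nonneg_left (herr t ht htT) hC
      simp only [V, zd, qd]
      linarith)
  set M₀ := |V 0| + C * (2 * n * d₁ ^ 2) / (η - 2 * δ) with hM₀
  have hM₀0 : 0 ≤ M₀ := by
    have : 0 < η - 2 * δ := by linarith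
    positivity
  refine ⟨K * (M₀ + 2 * n * d₁ ^ 2), by positivity, fun t ht htT i => ?_⟩
  have nonneg : ∀ x : ι → ℝ, 0 ≤ x ⬝ᵥ x := fun x => Finset.sum_nonneg fun i _ => mul_self_nonneg _
  set S := e t ⬝ᵥ e t + p t ⬝ᵥ p t + (ez t ⬝ᵥ ez t + ev t ⬝ᵥ ev t) with hS
  have hS0 : 0 ≤ S := add_nonneg (add_nonneg (nonneg _) (nonneg _))
    (add_nonneg (nonneg _) (nonneg _))
  have hSle : S ≤ k₀ * d₀ ^ 2 + (M₀ + 2 * n * d₁ ^ 2) * Real.exp (-(2 * δ) * t) := by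
    have h1 := key t ht htT
    have h2 := herr t ht htT
    have h3 : e t ⬝ᵥ e t ≤ α ^ 3 * (e t ⬝ᵥ e t) :=
      le_mul_of_one_le_left (nonneg _) (one_le_pow₀ hα)
    have h4 : C * (2 * n * d₀ ^ 2) / η = 2 * C * n / η * d₀ ^ 2 := by ring
    simp only [V] at h1
    rw [h4] at h1
    rw [hS, hk₀]
    linarith
  have hfin : ∀ x : ℝ, x ^ 2 ≤ K * S →
      x ^ 2 ≤ K * k₀ * d₀ ^ 2 + K * (M₀ + 2 * n * d₁ ^ 2) * Real.exp (-(2 * δ) * t) := by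
    intro x hx
    have := mul_le_mul_of_nonneg_left hSle (by linarith : 0 ≤ K)
    linarith
  have hlap : ∀ x : ι → ℝ, x ⬝ᵥ x ≤ S → lap a x i ^ 2 ≤ 2 * m ^ 2 * S := fun x hx =>
    (sq_le_dotProduct_self _ i).trans ((lap_dotProduct_lap_le_sq ha hm0 hD hmax x).trans
      (mul_le_mul_of_nonneg_left hx (by positivity)))
  have ne := nonneg (e t)
  have np := nonneg (p t)
  have nz := nonneg (ez t)
  have nv := nonneg (ev t)
  have b0 : h t i ^ 2 ≤ c₂ ^ 2 * S := (sq_le_dotProduct_self _ i).trans ((hhh t).trans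
      (mul_le_mul_of_nonneg_left (by linarith) (by positivity)))
  have b1 := hlap (e t) (by linarith)
  have b2 := hlap (p t) (by linarith)
  have b3 := hlap (ez t) (by linarith)
  have b4 := hlap (ev t) (by linarith)
  have pα := sq_nonneg α
  have pβ := sq_nonneg β
  have nm : 0 ≤ 2 * m ^ 2 * S := by positivity
  refine ⟨hfin _ ?_, hfin _ ?_, hfin _ ?_⟩
  · have h1 : (z i t - y) ^ 2 ≤ e t ⬝ᵥ e t := sq_le_dotProduct_self (e t) i
    have h2 : S ≤ K * S := le_mul_of_one_le_left hS0 hK1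
    linarith
  · have h1 : zd t i = -(α * h t i) + -(β * lap a (e t) i) + -(lap a (p t) i)
        + α * lap a (e t) i + -(β * lap a (ez t) i) + -(lap a (ev t) i) := by
      simp only [zd, lap_sub, lap_smul, Pi.sub_apply, Pi.smul_apply, smul_eq_mul]; ring
    have six : ∀ x₁ x₂ x₃ x₄ x₅ x₆ : ℝ, (x₁ + x₂ + x₃ + x₄ + x₅ + x₆) ^ 2
        ≤ 6 * (x₁ ^ 2 + x₂ ^ 2 + x₃ ^ 2 + x₄ ^ 2 + x₅ ^ 2 + x₆ ^ 2) := by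
      intro x₁ x₂ x₃ x₄ x₅ x₆
      have := sq_sum_le_card_mul_sum_sq (s := (Finset.univ : Finset (Fin 6)))
        (f := ![x₁, x₂, x₃, x₄, x₅, x₆])
      simpa [Fin.sum_univ_succ, add_assoc] using this
    rw [h1]
    refine (six _ _ _ _ _ _).trans ?_
    simp only [neg_sq, mul_pow]
    have q0 := mul_le_mul_of_nonneg_left b0 pα
    have q1 := mul_le_mul_of_nonneg_left b1 pα
    have q2 := mul_le_mul_of_nonneg_left b1 pβ
    have q3 := mul_le_mul_of_nonneg_left b3 pβ
    have q4 : 0 ≤ 4 * (α ^ 2 * β ^ 2) * (2 * m ^ 2) * S := by positivity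
    rw [hK]
    linarith only [q0, q1, q2, q3, q4, b2, b4, hS0]
  · have h1 : vd t i = α * β * (lap a (e t) i + lap a (ez t) i) := rfl
    have h2 : (lap a (e t) i + lap a (ez t) i) ^ 2 ≤ 2 * (2 * m ^ 2 * S) * 2 := by
      linarith only [sq_nonneg (lap a (e t) i - lap a (ez t) i), b1, b3]
    have q0 := mul_le_mul_of_nonneg_left h2 (mul_nonneg pα pβ)
    rw [h1, mul_pow, mul_pow, hK]
    have q4 : 0 ≤ 6 * (α ^ 2 * c₂ ^ 2 + (2 * β ^ 2 + α ^ 2 + 2) * (2 * m ^ 2)) * S := by positivity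
    linarith only [q0, q4, hS0]

/-- The mean value theorem for `f'`: the factor `k` is a value of the second derivative, which
yields both strong monotonicity and the Lipschitz bound. -/
theorem exists_deriv_sub_eq_mul {f : ℝ → ℝ} (hf : ContDiff ℝ 2 f) {a b : ℝ}
    (h : ∀ s, a ≤ iteratedDeriv 2 f s ∧ iteratedDeriv 2 f s ≤ b) (s y : ℝ) :
    ∃ k, a ≤ k ∧ k ≤ b ∧ deriv f s - deriv f y = k * (s - y) := by
  have hd : Differentiable ℝ (deriv f) := by
    have h1 := hf.differentiable_iteratedDeriv 1 (by norm_num)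
    rwa [iteratedDeriv_one] at h1
  have h2 : ∀ x, iteratedDeriv 2 f x = deriv (deriv f) x := fun x => by
    rw [iteratedDeriv_succ, iteratedDeriv_one]
  have key : ∀ p q : ℝ, p < q → ∃ k, a ≤ k ∧ k ≤ b ∧ deriv f q - deriv f p = k * (q - p) := by
    intro p q hpq
    obtain ⟨c, -, hc⟩ := exists_deriv_eq_slope (deriv f) hpq hd.continuous.continuousOn
      hd.differentiableOn
    refine ⟨_, (h c).1, (h c).2, ?_⟩
    rw [h2, hc, div_mul_cancel₀ _ (sub_pos.mpr hpq).ne']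
  rcases lt_trichotomy s y with hsy | hsy | hsy
  · obtain ⟨k, h1, h2, h3⟩ := key s y hsy
    exact ⟨k, h1, h2, by linarith⟩
  · exact ⟨_, (h 0).1, (h 0).2, by rw [hsy]; ring⟩
  · exact key y s hsy

theorem sum_deriv_eq_zero_of_forall_le {ι : Type*} [Fintype ι] {f : ι → ℝ → ℝ}
    (hf : ∀ i, Differentiable ℝ (f i)) {y : ℝ} (hy : ∀ s, ∑ i, f i y ≤ ∑ i, f i s) :
    ∑ i, deriv (f i) y = 0 := by
  have h1 : HasDerivAt (fun s => ∑ i, f i s) (∑ i, deriv (f i) y) y :=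
    HasDerivAt.fun_sum fun i _ => (hf i y).hasDerivAt
  exact IsLocalMin.hasDerivAt_eq_zero (Eventually.of_forall hy) h1

theorem abs_le_add_of_sq_le {x κ c M γ t : ℝ} (hκ : 0 ≤ κ) (hc : 0 ≤ c) (hM : 0 ≤ M)
    (h : x ^ 2 ≤ κ * c ^ 2 + M * Real.exp (-(2 * γ) * t)) :
    |x| ≤ √κ * c + √M * Real.exp (-γ * t) := by
  refine abs_le_of_sq_le_sq (h.trans ?_) (by positivity)
  have hexp : Real.exp (-(2 * γ) * t) = Real.exp (-γ * t) ^ 2 := by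
    rw [← Real.exp_nat_mul]; congr 1; push_cast; ring
  have h1 : 0 ≤ √κ * c * (√M * Real.exp (-γ * t)) := by positivity
  rw [add_sq, mul_pow, mul_pow, Real.sq_sqrt hκ, Real.sq_sqrt hM, hexp]
  linarith

/-- After a time `h ≤ 1 / (L + 2)` the error is at most the fraction `L h` of the initial threshold,
while at least `1 - h > L h` of the threshold is left. -/
theorem abs_lt_threshold_of_le {c₀ c₁ γ : ℝ} (h₀ : 0 ≤ c₀) (h₁ : 0 ≤ c₁) (h : 0 < c₀ + c₁)
    (hγ : γ ≤ 1) {L x s t : ℝ} (hL : 0 ≤ L) (hst : s ≤ t) (ht : t ≤ s + 1 / (L + 2))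
    (hx : x ≤ L * threshold c₀ c₁ γ s * (t - s)) : x < threshold c₀ c₁ γ t := by
  have h1 := one_sub_mul_threshold_le h₀ h₁ hγ hst
  have h2 := threshold_pos (γ := γ) h₀ h₁ h s
  have h3 : (t - s) * (L + 2) ≤ 1 := by
    rw [← le_div_iff₀ (by linarith)]; linarith
  have h4 : L * (t - s) < 1 - (t - s) := by
    rcases hst.eq_or_lt with h | h
    · rw [h]; simp
    · nlinarith
  nlinarith

theorem infDist_closedBall_le {x c R s : ℝ} (hR : 0 ≤ R) (hs : 0 ≤ s) (h : |x - c| ≤ R + s) :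
    Metric.infDist x (Metric.closedBall c R) ≤ s := by
  have h1 : x ∈ Metric.cthickening s (Metric.closedBall c R) := by
    rw [cthickening_closedBall hs hR, Metric.mem_closedBall, Real.dist_eq]
    linarith
  rw [Metric.mem_cthickening_iff] at h1
  exact ENNReal.toReal_le_of_le_ofReal hs h1

/-- An agent tracks its signal generator, and its feedback varies slowly, in proportion to the
distance of the generator from `y` and to the sampling error of the feedback. -/
theorem agent_bound {n : ℕ} (S : LinearAgent n) {K₁ X : Fin n → ℝ} {K₂ U : ℝ}
    {Q : Matrix (Fin n) (Fin n) ℝ} (hXU : S.SolvesRegulatorEquations X U)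
    (hK₂ : K₂ = U - K₁ ⬝ᵥ X) (hQ : Q.PosDef)
    (hLyap : (S.closedLoopMatrix K₁)ᵀ * Q + Q * S.closedLoopMatrix K₁ = -((2 : ℝ) • 1))
    (y : ℝ) {κ : ℝ} (hκ : 0 ≤ κ) :
    ∃ κ' : ℝ, 0 ≤ κ' ∧ ∀ (T : EReal) (c₀ c₁ γ M : ℝ) (x : ℝ → Fin n → ℝ) (u z z' : ℝ → ℝ),
      0 < γ → γ < 1 / (2 * maxEigenvalue Q) → 0 ≤ M →
      ContinuousOn x {t : ℝ | 0 ≤ t ∧ (t : EReal) < T} →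
      (∀ t : ℝ, 0 ≤ t → (t : EReal) < T →
        HasDerivWithinAt x (S.A *ᵥ x t + u t • S.B) (Ici t) t) →
      (∀ t : ℝ, 0 ≤ t → (t : EReal) < T → HasDerivWithinAt z (z' t) (Ici t) t) →
      (∀ t : ℝ, 0 ≤ t → (t : EReal) < T →
        (z t - y) ^ 2 ≤ κ * c₀ ^ 2 + M * Real.exp (-(2 * γ) * t) ∧
        z' t ^ 2 ≤ κ * c₀ ^ 2 + M * Real.exp (-(2 * γ) * t)) →
      (∀ t : ℝ, 0 ≤ t → (t : EReal) < T →
        |u t - (K₁ ⬝ᵥ x t + K₂ * z t)| ≤ threshold c₀ c₁ γ t) →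
      ∃ (M' : ℝ) (φ' : ℝ → ℝ), 0 ≤ M' ∧ ∀ t : ℝ, 0 ≤ t → (t : EReal) < T →
        (S.C ⬝ᵥ x t - y) ^ 2 ≤ κ' * c₀ ^ 2 + M' * Real.exp (-(2 * γ) * t) ∧
        HasDerivWithinAt (fun t => K₁ ⬝ᵥ x t + K₂ * z t) (φ' t) (Ici t) t ∧
        φ' t ^ 2 ≤ κ' * c₀ ^ 2 + M' * Real.exp (-(2 * γ) * t) := by
  obtain ⟨k, hk, hlin⟩ := linear_system_bound S.B hQ hLyap
  set F := S.closedLoopMatrix K₁ with hF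
  set cC := S.C ⬝ᵥ S.C
  set cF := (K₁ ᵥ* F) ⬝ᵥ (K₁ ᵥ* F)
  set cB := K₁ ⬝ᵥ S.B
  have hcC : 0 ≤ cC := Finset.sum_nonneg fun i _ => mul_self_nonneg _
  have hcF : 0 ≤ cF := Finset.sum_nonneg fun i _ => mul_self_nonneg _
  -- The coefficient of `c₀²` in the bound on `g²`; the `4` comes from splitting first `g` and then
  -- the threshold into two squares.
  set a := 2 * K₂ ^ 2 * κ + 4 with ha
  have ha0 : 0 ≤ a := by positivity
  refine ⟨(cC + 3 * cF) * (k * a) + 3 * cB ^ 2 * a + 3 * K₂ ^ 2 * κ, by positivity, ?_⟩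
  intro T c₀ c₁ γ M x u z z' hγ hγQ hM hxc hxd hzd hz hu
  set b := 2 * K₂ ^ 2 * M + 4 * c₁ ^ 2 with hb
  have hb0 : 0 ≤ b := by positivity
  let g : ℝ → ℝ := fun t => K₂ * (z t - y) + (u t - (K₁ ⬝ᵥ x t + K₂ * z t))
  have hg : ∀ t : ℝ, 0 ≤ t → (t : EReal) < T →
      g t ^ 2 ≤ a * c₀ ^ 2 + b * Real.exp (-(2 * γ) * t) := by
    intro t ht htT
    have h1 := (hz t ht htT).1
    have h2 : (u t - (K₁ ⬝ᵥ x t + K₂ * z t)) ^ 2 ≤ threshold c₀ c₁ γ t ^ 2 :=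
      sq_le_sq' (abs_le.mp (hu t ht htT)).1 (abs_le.mp (hu t ht htT)).2
    have h3 := h2.trans (threshold_sq_le t)
    have h4 := mul_le_mul_of_nonneg_left h1 (sq_nonneg K₂)
    have h5 := add_sq_le (a := K₂ * (z t - y)) (b := u t - (K₁ ⬝ᵥ x t + K₂ * z t))
    rw [mul_pow] at h5
    simp only [g, ha, hb]
    linarith
  -- The reference is the fixed equilibrium `y X`, not `z X`, so `z - y` is an input and `z'` does
  -- not enter the dynamics.
  have hxd_eq : ∀ t, S.A *ᵥ x t + u t • S.B = F *ᵥ (x t - y • X) + g t • S.B := by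
    intro t
    have h1 : S.A *ᵥ X = -(U • S.B) := eq_neg_of_add_eq_zero_left hXU.1
    have h2 : Matrix.vecMulVec S.B K₁ *ᵥ (x t - y • X) = (K₁ ⬝ᵥ (x t - y • X)) • S.B := by
      rw [vecMulVec_mulVec]; funext i; simp [mul_comm]
    rw [hF, LinearAgent.closedLoopMatrix, add_mulVec, h2, mulVec_sub, mulVec_smul, h1,
      dotProduct_sub, dotProduct_smul]
    funext i
    simp only [Pi.add_apply, Pi.sub_apply, Pi.smul_apply, Pi.neg_apply, smul_eq_mul, g, hK₂]
    ring
  have hζd : ∀ t : ℝ, 0 ≤ t → (t : EReal) < T → HasDerivWithinAt (fun t => x t - y • X)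
      (F *ᵥ (x t - y • X) + g t • S.B) (Ici t) t := by
    intro t ht htT
    rw [← hxd_eq]
    exact (hxd t ht htT).sub_const _
  obtain ⟨M', hM', hζ⟩ := hlin T γ (a * c₀ ^ 2) b (fun t => x t - y • X) g hγ hγQ (by positivity)
    hb0 (hxc.sub continuousOn_const) hζd hg
  refine ⟨(cC + 3 * cF) * M' + 3 * cB ^ 2 * b + 3 * K₂ ^ 2 * M,
    fun t => K₁ ⬝ᵥ (F *ᵥ (x t - y • X) + g t • S.B) + K₂ * z' t, by positivity,
    fun t ht htT => ⟨?_, ?_, ?_⟩⟩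
  all_goals
    have hexp := Real.exp_pos (-(2 * γ) * t)
    have hζt := hζ t ht htT
    have w1 := mul_le_mul_of_nonneg_left hζt hcC
    have w2 := mul_le_mul_of_nonneg_left hζt hcF
    have w3 := mul_le_mul_of_nonneg_left (hg t ht htT) (sq_nonneg cB)
    have w4 := mul_le_mul_of_nonneg_left (hz t ht htT).2 (sq_nonneg K₂)
  · have h1 : S.C ⬝ᵥ x t - y = S.C ⬝ᵥ (x t - y • X) := by
      rw [dotProduct_sub, dotProduct_smul, hXU.2]; simp
    rw [h1]
    have h2 := dotProduct_sq_le S.C (x t - y • X)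
    have n2 : 0 ≤ 3 * cF * (k * (a * c₀ ^ 2) + M' * Real.exp (-(2 * γ) * t)) := by positivity
    have n3 : 0 ≤ 3 * cB ^ 2 * (a * c₀ ^ 2 + b * Real.exp (-(2 * γ) * t)) := by positivity
    have n4 : 0 ≤ 3 * K₂ ^ 2 * (κ * c₀ ^ 2 + M * Real.exp (-(2 * γ) * t)) := by positivity
    linarith only [h2, w1, n2, n3, n4]
  · beta_reduce
    rw [← hxd_eq]
    have h1 := (hasDerivWithinAt_const t (Ici t) K₁).dotProduct (hxd t ht htT)
    rw [zero_dotProduct, zero_add] at h1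
    exact h1.add ((hzd t ht htT).const_mul K₂)
  · have h1 : K₁ ⬝ᵥ (F *ᵥ (x t - y • X) + g t • S.B) + K₂ * z' t
        = (K₁ ᵥ* F) ⬝ᵥ (x t - y • X) + cB * g t + K₂ * z' t := by
      rw [dotProduct_add, dotProduct_mulVec, dotProduct_smul, smul_eq_mul]; ring
    beta_reduce
    rw [h1]
    have h2 := dotProduct_sq_le (K₁ ᵥ* F) (x t - y • X)
    have three : ∀ p q r : ℝ, (p + q + r) ^ 2 ≤ 3 * (p ^ 2 + q ^ 2 + r ^ 2) := fun p q r => by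
      nlinarith [sq_nonneg (p - q), sq_nonneg (q - r), sq_nonneg (p - r)]
    refine (three _ _ _).trans ?_
    rw [mul_pow, mul_pow]
    have n1 : 0 ≤ cC * (k * (a * c₀ ^ 2) + M' * Real.exp (-(2 * γ) * t)) := by positivity
    linarith only [h2, w2, w3, w4, n1]

/-! ### Sampling errors along a trajectory and the main theorem -/

namespace ControlSetup.IsTrajectory

variable {N : ℕ} {n : Fin N → ℕ} {P : ControlSetup N n} {q : TriggerParams} {T : EReal}
  {w : Run N n}

theorem abs_input_sub_feedback_le (hw : P.IsTrajectory q T w)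
    (hθ : ∀ t, 0 ≤ threshold q.c₀ q.c₁ q.γ t) (i : Fin N) {t : ℝ} (ht : 0 ≤ t)
    (htT : (t : EReal) < T) :
    |w.u i t - P.feedback w i t| ≤ threshold q.c₀ q.c₁ q.γ t := by
  obtain ⟨k, hk, hk'⟩ := hw.ctrl_cover i t ht htT
  rw [hw.input_hold i k t htT hk hk']
  exact err_le_of_hold (err := fun s t => |P.feedback w i s - P.feedback w i t|)
    (hw.ctrl_succ i) hθ (by simp) htT hk hk'

theorem sq_add_sq_hold_error_le (hw : P.IsTrajectory q T w)
    (hθ : ∀ t, 0 ≤ threshold q.d₀ q.d₁ q.δ t) (i : Fin N) {t : ℝ} (ht : 0 ≤ t)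
    (htT : (t : EReal) < T) :
    (w.zt i t - w.z i t) ^ 2 + (w.vt i t - w.v i t) ^ 2 ≤ threshold q.d₀ q.d₁ q.δ t ^ 2 := by
  obtain ⟨k, hk, hk'⟩ := hw.comm_cover i t ht htT
  rw [hw.z_hold i k t htT hk hk', hw.v_hold i k t htT hk hk']
  have h := err_le_of_hold
    (err := fun s t => √((w.z i t - w.z i s) ^ 2 + (w.v i t - w.v i s) ^ 2))
    (hw.comm_succ i) hθ (by simp) htT hk hk'
  have h2 := (Real.sqrt_le_left (hθ t)).mp h
  linarith

end ControlSetup.IsTrajectory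

theorem theorem1 {N : ℕ} (hN : 2 ≤ N) {n : Fin N → ℕ} (P : ControlSetup N n)
    -- the agents: minimal, without transmission zeros at the origin
    (hmin : ∀ i, (P.agent i).IsMinimal)
    (hzero : ∀ i, ¬ (P.agent i).IsTransmissionZero 0)
    -- the costs
    (hf : ∀ i, ContDiff ℝ 2 (P.f i))
    (hlo hhi : Fin N → ℝ) (hlo_pos : ∀ i, 0 < hlo i)
    (hcurv : ∀ i s, hlo i ≤ iteratedDeriv 2 (P.f i) s ∧ iteratedDeriv 2 (P.f i) s ≤ hhi i)
    (ystar : ℝ) (hystar : ∀ s, ∑ i, P.f i ystar ≤ ∑ i, P.f i s)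
    -- the network
    (hconn : P.G.StronglyConnected) (hbal : P.G.WeightBalanced)
    -- the gains of the tracking controller
    (X : ∀ i, Fin (n i) → ℝ) (U : Fin N → ℝ)
    (hXU : ∀ i, (P.agent i).SolvesRegulatorEquations (X i) (U i))
    (hK₁ : ∀ i, IsHurwitz ((P.agent i).closedLoopMatrix (P.K₁ i)))
    (hK₂ : ∀ i, P.K₂ i = U i - P.K₁ i ⬝ᵥ X i)
    (Q : ∀ i, Matrix (Fin (n i)) (Fin (n i)) ℝ) (hQ : ∀ i, (Q i).PosDef)
    (hLyap : ∀ i, ((P.agent i).closedLoopMatrix (P.K₁ i))ᵀ * Q i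
      + Q i * (P.agent i).closedLoopMatrix (P.K₁ i) = -((2 : ℝ) • 1))
    -- the gains of the signal generator
    (lam₂ lamN : ℝ) (hlam₂ : lam₂ = P.G.lam ⟨1, hN⟩)
    (hlamN : lamN = P.G.lam ⟨N - 1, by omega⟩)
    (η : ℝ) (hη : 0 < η)
    (hα : max (max 1 (2 * η / min (⨅ i, hlo i) lam₂))
      (6 * (⨆ i, hhi i) ^ 2 / ((⨅ i, hlo i) * lam₂)) ≤ P.α)
    (hβ : max 1 (7 * P.α ^ 2 * lamN ^ 2 / lam₂ ^ 2) ≤ P.β) :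
    ∃ κ : ℝ, 0 < κ ∧ ∀ q : TriggerParams,
      0 ≤ q.d₀ → 0 ≤ q.d₁ → 0 < q.d₀ + q.d₁ → 0 < q.δ → q.δ < min 1 (η / 2) →
      q.d₀ ≤ q.c₀ → 0 ≤ q.c₁ → 0 < q.c₀ + q.c₁ → 0 < q.γ →
      (∀ i, q.γ < min (min 1 (1 / (2 * maxEigenvalue (Q i)))) q.δ) →
      -- (a) the inter-event times have a common positive lower bound
      (∀ (T : EReal) (w : Run N n), P.IsTrajectory q T w →
        ∃ τ : ℝ, 0 < τ ∧ ∀ i k,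
          (w.ctrl i k ≠ ⊤ → w.ctrl i k + (τ : EReal) < w.ctrl i (k + 1)) ∧
          (w.comm i k ≠ ⊤ → w.comm i k + (τ : EReal) < w.comm i (k + 1))) ∧
      -- (b) convergence into an interval of radius proportional to `c₀ + d₀`
      (∀ w : Run N n, P.IsTrajectory q ⊤ w → ∀ i,
        Tendsto (fun t => Metric.infDist (P.output w i t)
          (Metric.closedBall ystar (κ * (q.c₀ + q.d₀)))) atTop (𝓝 0)) ∧
      -- (c) exponential convergence when `c₀ = d₀ = 0`
      (q.c₀ = 0 → q.d₀ = 0 → ∃ ρ : ℝ, 0 < ρ ∧ ∀ w : Run N n, P.IsTrajectory q ⊤ w →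
        ∃ M : ℝ, ∀ i, ∀ t : ℝ, 0 ≤ t →
          |P.output w i t - ystar| ≤ M * Real.exp (-ρ * t)) := by
  have : Nonempty (Fin N) := ⟨⟨0, by omega⟩⟩
  set c₁ := ⨅ i, hlo i with hc₁
  set c₂ := ⨆ i, hhi i with hc₂
  have hc₁_le : ∀ i, c₁ ≤ hlo i := fun i => ciInf_le (finite_range hlo).bddBelow i
  have hc₂_le : ∀ i, hhi i ≤ c₂ := fun i => le_ciSup (finite_range hhi).bddAbove i
  have hc₁_pos : 0 < c₁ := by
    obtain ⟨i, hi⟩ := exists_eq_ciInf_of_finite (f := hlo)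
    rw [hc₁, ← hi]
    exact hlo_pos i
  have hl : 0 < lam₂ := hlam₂ ▸ P.G.lam_one_pos hN hconn hbal
  have hlm : lam₂ ≤ lamN := by
    rw [hlam₂, hlamN]
    exact P.G.lam_mono (Fin.mk_le_mk.mpr (by omega))
  simp only [max_le_iff] at hα hβ
  obtain ⟨⟨hα1, hαη⟩, hαc⟩ := hα
  obtain ⟨-, hβ⟩ := hβ
  have hα0 : 0 < P.α := by linarith
  rw [div_le_iff₀ (lt_min hc₁_pos hl)] at hαη
  rw [div_le_iff₀ (mul_pos hc₁_pos hl)] at hαc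
  rw [div_le_iff₀ (pow_pos hl 2)] at hβ
  have hη₁ : 2 * η ≤ P.α * c₁ :=
    hαη.trans (mul_le_mul_of_nonneg_left (min_le_left _ _) hα0.le)
  have hη₂ : 2 * η ≤ P.α * lam₂ :=
    hαη.trans (mul_le_mul_of_nonneg_left (min_le_right _ _) hα0.le)
  have hg : ∀ i s, ∃ k, c₁ ≤ k ∧ k ≤ c₂ ∧
      deriv (P.f i) s - deriv (P.f i) ystar = k * (s - ystar) := fun i s =>
    exists_deriv_sub_eq_mul (hf i)
      (fun s => ⟨(hc₁_le i).trans (hcurv i s).1, (hcurv i s).2.trans (hc₂_le i)⟩) s ystar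
  obtain ⟨κz, hκz, hgen⟩ := generator_bound (a := P.G.weight) P.G.weight_nonneg hbal hl hlm
    (fun i => hlamN ▸ P.G.degree_le_lam_last hN hbal i)
    (fun x hx => hlam₂ ▸ P.G.lam_one_mul_le_disagreement hN hconn hbal x hx)
    (fun x => hlamN ▸ P.G.disagreement_le hN hbal x) hη hα1 hη₁ hη₂ hαc hβ
    (g := fun i => deriv (P.f i)) (y := ystar)
    (sum_deriv_eq_zero_of_forall_le (fun i => (hf i).differentiable (by norm_num)) hystar)
    (fun i s => by
      obtain ⟨k, hk, -, hk'⟩ := hg i s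
      rw [hk']
      linarith [mul_le_mul_of_nonneg_right hk (sq_nonneg (s - ystar))])
    (fun i s => by
      obtain ⟨k, hk, hk₂, hk'⟩ := hg i s
      rw [hk', mul_pow]
      gcongr
      linarith)
  choose κ hκ hagent using fun i => agent_bound (P.agent i) (hXU i) (hK₂ i) (hQ i) (hLyap i)
    ystar hκz
  -- The sum dominates each `√(κ i)`, and the `1` makes the constant strictly positive. It is fixed
  -- before the triggering parameters and the trajectory.
  refine ⟨1 + ∑ i, √(κ i), by positivity, ?_⟩
  intro q hd₀ hd₁ hd hδ hδη hc₀ hc₁' hc hγ hγ'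
  have hc₀0 : 0 ≤ q.c₀ := hd₀.trans hc₀
  obtain ⟨hδ1, hδη⟩ := lt_min_iff.mp hδη
  simp only [lt_min_iff] at hγ'
  have hγδ : q.γ < q.δ := (hγ' ⟨0, by omega⟩).2
  have hγ1 : q.γ < 1 := (hγ' ⟨0, by omega⟩).1.1
  have hθc : ∀ t, 0 ≤ threshold q.c₀ q.c₁ q.γ t := fun t => (threshold_pos hc₀0 hc₁' hc t).le
  have hθd : ∀ t, 0 ≤ threshold q.d₀ q.d₁ q.δ t := fun t => (threshold_pos hd₀ hd₁ hd t).le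
  have generator : ∀ (T : EReal) (w : Run N n), P.IsTrajectory q T w → _ := fun T w hw =>
    hgen T q.d₀ q.d₁ q.δ w.z w.v w.zt w.vt hδ.le (by linarith) hw.z_cont hw.v_cont hw.z_deriv
      hw.v_deriv (fun i t => hw.sq_add_sq_hold_error_le hθd i)
  have agents : ∀ (T : EReal) (w : Run N n), P.IsTrajectory q T w → ∀ i,
      ∃ (M : ℝ) (φ' : ℝ → ℝ), 0 ≤ M ∧ ∀ t : ℝ, 0 ≤ t → (t : EReal) < T →
        (P.output w i t - ystar) ^ 2 ≤ κ i * q.c₀ ^ 2 + M * Real.exp (-(2 * q.γ) * t) ∧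
        HasDerivWithinAt (P.feedback w i) (φ' t) (Ici t) t ∧
        φ' t ^ 2 ≤ κ i * q.c₀ ^ 2 + M * Real.exp (-(2 * q.γ) * t) := fun T w hw i => by
    obtain ⟨M, hM, hz⟩ := generator T w hw
    exact hagent i T q.c₀ q.c₁ q.γ M (w.x i) (w.u i) (w.z i) _ hγ (hγ' i).1.2 hM (hw.x_cont i)
      (hw.x_deriv i) (hw.z_deriv i) (fun t ht htT => by
        -- This is where `d₀ ≤ c₀` and `γ < δ` are needed: they make the generator's error
        -- admissible on the scale of the control threshold.
        have h1 : κz * q.d₀ ^ 2 + M * Real.exp (-(2 * q.δ) * t)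
            ≤ κz * q.c₀ ^ 2 + M * Real.exp (-(2 * q.γ) * t) := by
          gcongr κz * ?_ ^ 2 + M * Real.exp ?_
          nlinarith
        exact ⟨(hz t ht htT i).1.trans h1, (hz t ht htT i).2.1.trans h1⟩)
      (fun t => hw.abs_input_sub_feedback_le hθc i)
  have outputs : ∀ w : Run N n, P.IsTrajectory q ⊤ w → ∀ i, ∃ M : ℝ, 0 ≤ M ∧ ∀ t : ℝ, 0 ≤ t →
      |P.output w i t - ystar| ≤ √(κ i) * q.c₀ + M * Real.exp (-q.γ * t) := by
    intro w hw i
    obtain ⟨M, φ', hM, h⟩ := agents ⊤ w hw i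
    exact ⟨√M, Real.sqrt_nonneg _, fun t ht =>
      abs_le_add_of_sq_le (hκ i) hc₀0 hM (h t ht (EReal.coe_lt_top t)).1⟩
  refine ⟨fun T w hw => ?_, fun w hw i => ?_, fun hc₀z _ => ⟨q.γ, hγ, fun w hw => ?_⟩⟩
  · obtain ⟨Mz, hMz, hz⟩ := generator T w hw
    obtain ⟨L, hL, hLz⟩ := exists_le_mul_threshold hd₀ hd₁ hd hδ.le hκz hMz
    -- The norm of the error is at most the sum of the increments of `z` and `v`, each growing at a
    -- rate of at most `L` times the threshold; hence `2 * L`. The final halving supplies the slack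
    -- in `add_lt_next_event`.
    have hcomm : ∀ i k, w.comm i k ≠ ⊤ →
        w.comm i k + ((1 / (2 * L + 2) / 2 : ℝ) : EReal) < w.comm i (k + 1) := by
      intro i k hk
      refine add_lt_next_event
        (err := fun s t => √((w.z i t - w.z i s) ^ 2 + (w.v i t - w.v i s) ^ 2))
        hw.pos (hw.comm_zero i) (hw.comm_succ i) (by positivity) (fun s t hs hst htT ht => ?_) hk
      refine abs_lt_threshold_of_le hd₀ hd₁ hd hδ1.le (L := 2 * L) (by positivity) hst
        (by linarith) ?_
      have h1 := abs_sub_le_of_deriv_le_threshold hd₁ hδ.le (hw.z_cont i) (hw.z_deriv i) hL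
        (fun t ht htT => hLz t _ ht (hz t ht htT i).2.1) hs hst htT
      have h2 := abs_sub_le_of_deriv_le_threshold hd₁ hδ.le (hw.v_cont i) (hw.v_deriv i) hL
        (fun t ht htT => hLz t _ ht (hz t ht htT i).2.2) hs hst htT
      have h3 : √((w.z i t - w.z i s) ^ 2 + (w.v i t - w.v i s) ^ 2)
          ≤ |w.z i t - w.z i s| + |w.v i t - w.v i s| := by
        rw [Real.sqrt_le_left (by positivity), add_sq, sq_abs, sq_abs]
        have : 0 ≤ |w.z i t - w.z i s| * |w.v i t - w.v i s| := by positivity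
        linarith
      linarith
    have hctrl : ∀ i, ∃ τ : ℝ, 0 < τ ∧ ∀ k, w.ctrl i k ≠ ⊤ →
        w.ctrl i k + (τ : EReal) < w.ctrl i (k + 1) := by
      intro i
      obtain ⟨M, φ', hM, h⟩ := agents T w hw i
      obtain ⟨L, hL, hLx⟩ := exists_le_mul_threshold hc₀0 hc₁' hc hγ.le (hκ i) hM
      refine ⟨1 / (L + 2) / 2, by positivity, fun k hk => ?_⟩
      refine add_lt_next_event (err := fun s t => |P.feedback w i s - P.feedback w i t|)
        hw.pos (hw.ctrl_zero i) (hw.ctrl_succ i) (by positivity) (fun s t hs hst htT ht => ?_) hk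
      refine abs_lt_threshold_of_le hc₀0 hc₁' hc hγ1.le hL hst (by linarith) ?_
      rw [abs_sub_comm]
      exact abs_sub_le_of_deriv_le_threshold hc₁' hγ.le
        ((continuousOn_const.dotProduct' (hw.x_cont i)).add
          (continuousOn_const.mul (hw.z_cont i)))
        (fun t ht htT => (h t ht htT).2.1) hL
        (fun t ht htT => hLx t _ ht (h t ht htT).2.2) hs hst htT
    choose τ hτ hctrl using hctrl
    obtain ⟨i₀, hi₀⟩ := Finite.exists_min τ
    refine ⟨min (τ i₀) (1 / (2 * L + 2) / 2), lt_min (hτ i₀) (by positivity), fun i k =>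
      ⟨fun hk => lt_of_le_of_lt ?_ (hctrl i k hk), fun hk => lt_of_le_of_lt ?_ (hcomm i k hk)⟩⟩
    · gcongr
      exact (min_le_left _ _).trans (hi₀ i)
    · gcongr
      exact min_le_right _ _
  · obtain ⟨M, hM, h⟩ := outputs w hw i
    have hlim : Tendsto (fun t => M * Real.exp (-q.γ * t)) atTop (𝓝 0) := by
      have h1 : Tendsto (fun t => Real.exp (-q.γ * t)) atTop (𝓝 0) :=
        Real.tendsto_exp_atBot.comp (tendsto_id.const_mul_atTop_of_neg (by linarith))
      simpa using h1.const_mul M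
    refine tendsto_of_tendsto_of_tendsto_of_le_of_le' tendsto_const_nhds hlim
      (Eventually.of_forall fun t => Metric.infDist_nonneg) ?_
    filter_upwards [eventually_ge_atTop 0] with t ht
    refine infDist_closedBall_le (by positivity) (by positivity) ((h t ht).trans ?_)
    have h1 : √(κ i) ≤ ∑ j, √(κ j) :=
      Finset.single_le_sum (f := fun j => √(κ j)) (fun j _ => Real.sqrt_nonneg _)
        (Finset.mem_univ i)
    gcongr
    · linarith
    · linarith
  · choose M hM h using outputs w hw
    refine ⟨∑ i, M i, fun i t ht => (h i t ht).trans ?_⟩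
    rw [hc₀z, mul_zero, zero_add]
    gcongr
    exact Finset.single_le_sum (fun j _ => hM j) (Finset.mem_univ i)
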